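/- **SLOCAL model.** Networks are finite simple graphs with input labels on nodes and half-edges (a half-edge is a pair of a node and an incident edge); on $n$ nodes, the nodes have unique identifiers from $\{1,\dots,n^c\}$, where $c\ge 1$ is a fixed constant. A deterministic SLOCAL algorithm of locality $T(n)$ processes the nodes one by one in an adversarial order. When $v$ is processed, it sees $n$, and the subgraph induced by the nodes at distance at most $T(n)$ from $v$, with identifiers, input labels (including the labels of all half-edges of these nodes) and current states; the new state of $v$, which contains its output, is an arbitrary function of this. A problem has SLOCAL complexity at most $T(n)$ if some such algorithm produces a valid output on every instance, for all identifiers and all orders. **Linearizable problems.** Such a problem $P=(\Sigma,(F,L,R),B)$ of rank $\Delta$ consists of a finite label set $\Sigma$, sets $F,L\subseteq\Sigma$ and $R\subseteq\Sigma\times\Sigma$, and a finite set $B$ of multisets over $\Sigma$. Its instances are the finite bipartite graphs, possibly with parallel edges, with white and black nodes, in which black nodes have degree at most $\Delta$ and the incident edges of each white node are ordered. Every node knows its colour and adjacent nodes know the positions of the edges joining them. Every white node outputs a label in $\Sigma$ for each incident edge. If $\ell_1,\dots,\ell_d$ with $d\ge1$ are the labels of the edges of a white node in their order, then $\ell_1\in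 F$, $\ell_d\in L$ and $(\ell_i,\ell_{i+1})\in R$ for $1\le i<d$; the multiset of labels at every non-isolated black node is in $B$. **The graph family $\mathcal G$.** A *tree-like gadget* of height $h\geq 1$ has the nodes $(l,k)$ with $0\le l<h$, $0\le k<2^l$, with edges between $(l,k)$ and $(l,k+1)$ and between $(l,k)$ and its children $(l+1,2k)$, $(l+1,2k+1)$. An *octopus gadget* consists of a tree-like head-gadget and, for each leaf of it, one or two tree-like port-gadgets, whose roots are joined to this leaf. A *proper instance* consists of disjoint octopus gadgets and pairwise non-adjacent inter-octopus nodes of degree at most $\Delta$, where the left-most leaf of each port-gadget is adjacent to exactly one inter-octopus node, and there are no other edges. The input labels say for each node whether it is a head, port or inter-octopus node, and for each half-edge whether it leads to the left or right neighbour in the layer, the parent, the left or right child, the first or second port-gadget, the head-gadget, the inter-octopus node, or the port-gadget. The following constraints at a node $u$ check locally that a graph is a so-labelled proper instance, and $\mathcal G$ is the family of labelled graphs that satisfy them at all nodes: - the two labels of each edge at $u$ match each other and the kinds of its endpoints (left/right, parent/child inside one kind; port/head between head and port nodes; to-inter/to-port between port and inter-octopus nodes); - if $u$ is not an inter-octopus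 node, its half-edge labels are distinct; if it is one, its degree is at most $\Delta$; - $u$ has a left child iff it has a right child, and the right child is then the right neighbour of the left child; if $u$ has a right neighbour $v$, then $u$ has children iff $v$ has, and the left child of $v$ is then the right neighbour of the right child of $u$; - if $u$ has no parent, it has no left and no right neighbour; if $u$ is the left (right) child of $p$, then $u$ has a left (right) neighbour iff $p$ has; - a head node has a first port-gadget iff it has no children, and a second one only if it has no children; a port node has a half-edge to the head-gadget iff it has no parent, and a half-edge to an inter-octopus node iff it has neither children nor a left neighbour. **The problem $\mathrm{lift}(P)$.** Its inputs are all finite simple graphs with input labels as above. Each node is either marked with one of error, up, down, or is unmarked and outputs $\bot$ or a label in $\Sigma$. The output is valid if the following holds. - An error node violates the constraints in the input graph. A node marked up has a marked node above it, along a half-edge to the parent or to the head-gadget. A node marked down has below it, along a half-edge to a child, to a port-gadget or to an inter-octopus node, a node marked error or down. An unmarked node satisfies the constraints in the subgraph induced by the unmarked nodes (so this subgraph is in $\mathcal G$). - In the subgraph induced by the unmarked nodes: exactly the nodes of port-gadgets output a label in $\Sigma$, and all nodes of the same port-gadget output the same one; the labels $\ell_1,\dots,\ell_d$ of the port-gadgets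 of an octopus gadget, from left to right, satisfy $\ell_1\in F$, $\ell_d\in L$ and $(\ell_i,\ell_{i+1})\in R$ for $1\le i<d$; the multiset of the labels of the port-gadgets adjacent to a non-isolated inter-octopus node is in $B$. **Lemma.** Let $P$ be a linearizable problem and $T:\mathbb N\to\mathbb N$ with $T(n)\ge1$ for all $n$. If $P$ has SLOCAL complexity at most $T(n)$ on its instances, which may have parallel edges, then $\mathrm{lift}(P)$ has SLOCAL complexity $O(T(n)\log n)$. -/

import Mathlib

open Filter Asymptotics

/-! ### Labelled graphs -/

/-- A finite simple graph in which every node `v` carries a label `node v` and every half-edge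
`(v, {v, u})` carries a label `half v u` (the value is meaningful only if `v` and `u` are
adjacent). -/
structure LabeledGraph (X E : Type) where
  V : Type
  [fintypeV : Fintype V]
  graph : SimpleGraph V
  node : V → X
  half : V → V → E

attribute [instance] LabeledGraph.fintypeV

namespace LabeledGraph

variable {X E : Type}

/-- The set of neighbours of `u`. -/
noncomputable def nbrs (G : LabeledGraph X E) (u : G.V) : Finset G.V :=
  open Classical in Finset.univ.filter fun v => G.graph.Adj u v

/-- `v` is reached from `u` through a half-edge of `u` that is labelled `a`. -/
def Step (G : LabeledGraph X E) (a : E) (u v : G.V) : Prop :=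
  G.graph.Adj u v ∧ G.half u v = a

/-- Some half-edge of `u` is labelled `a`. -/
def Has (G : LabeledGraph X E) (a : E) (u : G.V) : Prop :=
  ∃ v, G.Step a u v

/-- The subgraph induced by `S`; the nodes outside `S` are kept as isolated nodes, so that the node
type does not change. -/
def keep (G : LabeledGraph X E) (S : Set G.V) : LabeledGraph X E where
  V := G.V
  graph :=
    { Adj := fun u v => G.graph.Adj u v ∧ u ∈ S ∧ v ∈ S
      symm := ⟨fun _ _ h => ⟨h.1.symm, h.2.2, h.2.1⟩⟩
      loopless := ⟨fun _ h => h.1.ne rfl⟩ }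
  node := G.node
  half := G.half

end LabeledGraph

/-! ### The SLOCAL model -/

/-- What a node sees when it queries its radius-`T` neighbourhood. Nodes are named by their
identifiers. `n` is the number of nodes of the network and `center` the identifier of the querying
node. For every node of the neighbourhood, `info` gives its input label, the labels of all its
half-edges and its current state (`none` for a node that has not been processed yet); for every
edge between two nodes of the neighbourhood, `edge` gives the labels of its two half-edges. -/
structure View (X E S : Type) where
  n : ℕ
  center : ℕ
  info : ℕ → Option (X × Multiset E × Option S)
  edge : ℕ → ℕ → Option E

/-- The radius-`T` view of `v` when the current states of the nodes are given by `σ`. -/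
noncomputable def LabeledGraph.view {X E S : Type} (G : LabeledGraph X E) (ident : G.V → ℕ)
    (T : ℕ) (σ : G.V → Option S) (v : G.V) : View X E S :=
  open Classical in
  { n := Fintype.card G.V
    center := ident v
    info := fun i =>
      if h : ∃ u, ident u = i ∧ G.graph.edist v u ≤ T then
        some (G.node h.choose, (G.nbrs h.choose).val.map (G.half h.choose), σ h.choose)
      else none
    edge := fun i j =>
      if h : ∃ p : G.V × G.V, ident p.1 = i ∧ ident p.2 = j ∧ G.graph.edist v p.1 ≤ T ∧
          G.graph.edist v p.2 ≤ T ∧ G.graph.Adj p.1 p.2 then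
        some (G.half h.choose.1 h.choose.2)
      else none }

/-- A deterministic SLOCAL algorithm: an arbitrary function that maps the view of the processed node
to the new state of this node. The output of the node is a part of its state. -/
structure SLOCALAlgorithm (X E Y : Type) where
  State : Type
  step : View X E State → State
  output : State → Y

/-- The states after the nodes of the list `order` have been processed one after the other, each of
them with a query of radius `T`. -/
noncomputable def SLOCALAlgorithm.run {X E Y : Type} (A : SLOCALAlgorithm X E Y)
    (G : LabeledGraph X E) (ident : G.V → ℕ) (T : ℕ) (order : List G.V) : G.V → Option A.State :=
  open Classical in
  order.foldl (fun σ v => Function.update σ v (some (A.step (G.view ident T σ v)))) fun _ => none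

/-- A distributed problem: a class of instances, the network of each instance with its input labels,
and the valid outputs. -/
structure DistributedProblem (X E Y : Type) where
  Inst : Type 1
  net : Inst → LabeledGraph X E
  Valid : (I : Inst) → ((net I).V → Y) → Prop

/-- Unique identifiers from `{1, …, n ^ c}`, where `n` is the number of nodes. -/
def IsIdentifierAssignment {V : Type} [Fintype V] (c : ℕ) (ident : V → ℕ) : Prop :=
  Function.Injective ident ∧ ∀ v, 1 ≤ ident v ∧ ident v ≤ Fintype.card V ^ c

/-- `T` is an upper bound on the SLOCAL complexity of the problem `Q`: some SLOCAL algorithm that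
queries radius `T n` on networks with `n` nodes produces a valid output on every instance, for all
identifiers from `{1, …, n ^ c}` and every processing order. -/
def SolvableInSLOCAL {X E Y : Type} (c : ℕ) (Q : DistributedProblem X E Y) (T : ℕ → ℕ) : Prop :=
  ∃ A : SLOCALAlgorithm X E Y, ∀ (I : Q.Inst) (ident : (Q.net I).V → ℕ),
    IsIdentifierAssignment c ident →
    ∀ order : List (Q.net I).V, order.Nodup → (∀ v, v ∈ order) →
      ∃ y : (Q.net I).V → Y,
        (∀ v, (A.run (Q.net I) ident (T (Fintype.card (Q.net I).V)) order v).map A.output =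
          some (y v)) ∧
        Q.Valid I y

/-! ### Linearizable problems -/

/-- A linearizable problem with the finite label set `Γ`, on hypergraphs of rank at most `rank`. -/
structure LinearizableProblem (Γ : Type) where
  first : Finset Γ
  last : Finset Γ
  pairs : Finset (Γ × Γ)
  black : Finset (Multiset Γ)
  rank : ℕ

/-- A bipartite multigraph, possibly with parallel edges, with white nodes `W` and black nodes `B`:
the incident edges of each white node `w` are ordered, and the `i`-th of its `deg w` incident edges
leads to the black node `nbr w i`. -/
structure IncidenceMultigraph where
  W : Type
  B : Type
  [fintypeW : Fintype W]
  [fintypeB : Fintype B]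
  deg : W → ℕ
  nbr : (w : W) → Fin (deg w) → B

attribute [instance] IncidenceMultigraph.fintypeW IncidenceMultigraph.fintypeB

inductive Color
  | white
  | black

namespace IncidenceMultigraph

/-- The edges, named by their white endpoint and their position there, that are incident to the
black node `b`. -/
noncomputable def edgesAt (M : IncidenceMultigraph) (b : M.B) : Finset (Σ w : M.W, Fin (M.deg w)) :=
  open Classical in Finset.univ.filter fun e => M.nbr e.1 e.2 = b

/-- The positions, in the ordering of the edges of the white node `w`, of the parallel edges that
join `w` and `b`. -/
noncomputable def positions (M : IncidenceMultigraph) (w : M.W) (b : M.B) : Finset ℕ :=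
  open Classical in (Finset.univ.filter fun i => M.nbr w i = b).map Fin.valEmbedding

/-- The multigraph as a network: all nodes, white and black, compute; every node knows its colour,
and two adjacent nodes know the positions of the edges that join them. -/
noncomputable def net (M : IncidenceMultigraph) : LabeledGraph Color (Finset ℕ) where
  V := M.W ⊕ M.B
  graph := SimpleGraph.fromRel fun x y => ∃ w i, x = Sum.inl w ∧ y = Sum.inr (M.nbr w i)
  node := Sum.elim (fun _ => Color.white) (fun _ => Color.black)
  half := fun x y =>
    match x, y with
    | Sum.inl w, Sum.inr b => M.positions w b
    | Sum.inr b, Sum.inl w => M.positions w b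
    | _, _ => ∅

end IncidenceMultigraph

namespace LinearizableProblem

variable {Γ : Type}

/-- The white constraint for a node whose `d` incident edges are labelled `ℓ 0, …, ℓ (d - 1)`. -/
def WhiteOk (P : LinearizableProblem Γ) (d : ℕ) (ℓ : ℕ → Γ) : Prop :=
  (0 < d → ℓ 0 ∈ P.first ∧ ℓ (d - 1) ∈ P.last) ∧ ∀ i, i + 1 < d → (ℓ i, ℓ (i + 1)) ∈ P.pairs

/-- The black constraint; a node without incident edges carries no constraint. -/
def BlackOk (P : LinearizableProblem Γ) (m : Multiset Γ) : Prop :=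
  m ≠ 0 → m ∈ P.black

/-- The linearizable problem as a distributed problem, on all bipartite multigraphs whose black
nodes have degree at most the rank. A white node `w` outputs the labels of its incident edges: the
`i`-th one is labelled `y w i`. The outputs of the black nodes are ignored. -/
noncomputable def problem (P : LinearizableProblem Γ) :
    DistributedProblem Color (Finset ℕ) (ℕ → Γ) where
  Inst := {M : IncidenceMultigraph // ∀ b, (M.edgesAt b).card ≤ P.rank}
  net := fun M => M.1.net
  Valid := fun M y =>
    (∀ w : M.1.W, P.WhiteOk (M.1.deg w) (y (Sum.inl w))) ∧
    ∀ b : M.1.B, P.BlackOk ((M.1.edgesAt b).val.map fun e => y (Sum.inl e.1) e.2)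

end LinearizableProblem

/-! ### Proper instances and their local constraints -/

/-- The input labels of nodes: a node of a head-gadget, a node of a port-gadget, or an inter-octopus
node. -/
inductive NodeKind
  | head
  | port
  | inter

/-- The input labels of half-edges. The first five describe a tree-like gadget: the half-edge leads
to the left or right neighbour in the same layer, to the parent, or to the left or right child.
From a leaf of a head-gadget, `port1` and `port2` lead to the roots of the port-gadgets attached to
it, and `toHead` leads back. From the left-most leaf of a port-gadget, `toInter` leads to an
inter-octopus node, and `toPort` leads back. -/
inductive HalfEdgeLabel
  | left
  | right
  | parent
  | leftChild
  | rightChild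
  | port1
  | port2
  | toHead
  | toInter
  | toPort

/-- `EdgeOk k a b k'`: an edge may join a node of kind `k`, with label `a` at its half-edge, to a
node of kind `k'`, with label `b` at its half-edge. -/
inductive EdgeOk : NodeKind → HalfEdgeLabel → HalfEdgeLabel → NodeKind → Prop
  | right (k : NodeKind) (hk : k ≠ .inter) : EdgeOk k .right .left k
  | leftChild (k : NodeKind) (hk : k ≠ .inter) : EdgeOk k .leftChild .parent k
  | rightChild (k : NodeKind) (hk : k ≠ .inter) : EdgeOk k .rightChild .parent k
  | port1 : EdgeOk .head .port1 .toHead .port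
  | port2 : EdgeOk .head .port2 .toHead .port
  | toInter : EdgeOk .port .toInter .toPort .inter
  | symm {k k' : NodeKind} {a b : HalfEdgeLabel} (h : EdgeOk k a b k') : EdgeOk k' b a k

/-- Graphs with the input labels of the lifted problem. -/
abbrev GadgetGraph := LabeledGraph NodeKind HalfEdgeLabel

namespace GadgetGraph

open HalfEdgeLabel

/-- The local constraint at `u`. It inspects only the radius-`2` neighbourhood of `u`. The graphs
that satisfy it at all nodes are the labelled proper instances: disjoint octopus gadgets, in which
the left-most leaf of each port-gadget is adjacent to exactly one inter-octopus node, where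
inter-octopus nodes are pairwise non-adjacent and have degree at most `rank`. -/
structure Constraint (G : GadgetGraph) (rank : ℕ) (u : G.V) : Prop where
  edge_ok : ∀ v, G.graph.Adj u v → EdgeOk (G.node u) (G.half u v) (G.half v u) (G.node v)
  distinct : G.node u ≠ .inter →
    ∀ v w, G.graph.Adj u v → G.graph.Adj u w → G.half u v = G.half u w → v = w
  inter_degree : G.node u = .inter → (G.nbrs u).card ≤ rank
  -- both children or none, and the two children are consecutive in their layer
  children_iff : G.Has leftChild u ↔ G.Has rightChild u
  siblings : ∀ v w, G.Step leftChild u v → G.Step rightChild u w → G.Step right v w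
  -- consecutive nodes of a layer: both are leaves or none, and their children are consecutive
  layer_iff : ∀ v, G.Step right u v → (G.Has leftChild u ↔ G.Has leftChild v)
  cousins : ∀ v a b, G.Step right u v → G.Step rightChild u a → G.Step leftChild v b →
    G.Step right a b
  -- the layer of the root consists of the root, and layers end where the layer above ends
  root_alone : ¬ G.Has parent u → ¬ G.Has left u ∧ ¬ G.Has right u
  left_end : ∀ p, G.Step leftChild p u → (G.Has left u ↔ G.Has left p)
  right_end : ∀ p, G.Step rightChild p u → (G.Has right u ↔ G.Has right p)
  -- head-gadgets: one or two port-gadgets at each leaf, none elsewhere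
  head_port1 : G.node u = .head → (G.Has port1 u ↔ ¬ G.Has leftChild u)
  head_port2 : G.node u = .head → G.Has port2 u → ¬ G.Has leftChild u
  -- port-gadgets: exactly the root is attached to a head-gadget, and exactly the left-most leaf
  -- is attached to an inter-octopus node
  port_root : G.node u = .port → (G.Has toHead u ↔ ¬ G.Has parent u)
  port_leaf : G.node u = .port → (G.Has toInter u ↔ ¬ G.Has leftChild u ∧ ¬ G.Has left u)

/-- The family of labelled graphs that satisfy the local constraints at all nodes. -/
def InFamily (G : GadgetGraph) (rank : ℕ) : Prop :=
  ∀ u, Constraint G rank u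

/-- From a node of a gadget to its parent, or from the root of a port-gadget to the head-gadget. -/
def StepUp (G : GadgetGraph) (u v : G.V) : Prop :=
  G.Step parent u v ∨ G.Step toHead u v

/-- From a node of a gadget to one of its children, from a leaf of a head-gadget to the root of an
attached port-gadget, or from a port-gadget to the attached inter-octopus node. -/
def StepDown (G : GadgetGraph) (u v : G.V) : Prop :=
  G.Step leftChild u v ∨ G.Step rightChild u v ∨ G.Step port1 u v ∨ G.Step port2 u v ∨
    G.Step toInter u v

/-- `v` is the root of the right-most port-gadget attached to the head-gadget leaf `u`. -/
def LastPort (G : GadgetGraph) (u v : G.V) : Prop :=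
  G.Step port2 u v ∨ (¬ G.Has port2 u ∧ G.Step port1 u v)

end GadgetGraph

/-! ### The lifted problem -/

/-- The output labels: a node is marked, either as an error or with a pointer up or down that leads
to an error, or it is unmarked and outputs `⊥` (written `none`) or a label of the linearizable
problem. -/
inductive LiftOutput (Γ : Type)
  | error
  | up
  | down
  | unmarked (o : Option Γ)

namespace LiftOutput

variable {Γ : Type}

def IsUnmarked (y : LiftOutput Γ) : Prop :=
  ∃ o, y = unmarked o

def label : LiftOutput Γ → Option Γ
  | unmarked o => o
  | _ => none

end LiftOutput

namespace GadgetGraph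

variable {Γ : Type}

open HalfEdgeLabel

/-- The local rule, at `u`, of the problem that marks the nodes that are not in a proper instance:
an error node violates the local constraint; a node with an up-pointer has a marked node above it;
a node with a down-pointer has below it a node that is an error or has a down-pointer; an unmarked
node satisfies the local constraint in the subgraph induced by the unmarked nodes. -/
def BadGraphRule (G : GadgetGraph) (rank : ℕ) (y : G.V → LiftOutput Γ) (u : G.V) : Prop :=
  match y u with
  | .error => ¬ Constraint G rank u
  | .up => ∃ v, StepUp G u v ∧ ¬ (y v).IsUnmarked
  | .down => ∃ v, StepDown G u v ∧ (y v = .error ∨ y v = .down)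
  | .unmarked _ => Constraint (G.keep {v | (y v).IsUnmarked}) rank u

/-- The local rule, at `u`, of the promise problem with respect to the node labels `ℓ`. -/
structure PromiseRule (G : GadgetGraph) (P : LinearizableProblem Γ) (ℓ : G.V → Option Γ)
    (u : G.V) : Prop where
  port_iff : (ℓ u).isSome ↔ G.node u = .port
  same_port : ∀ v, G.graph.Adj u v → G.node u = .port → G.node v = .port → ℓ u = ℓ v
  -- the port-gadgets of an octopus gadget in their left-to-right order
  first : ∀ v a, G.node u = .head → ¬ G.Has left u → G.Step port1 u v → ℓ v = some a →
    a ∈ P.first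
  last : ∀ v a, G.node u = .head → ¬ G.Has right u → LastPort G u v → ℓ v = some a →
    a ∈ P.last
  pair_same_leaf : ∀ v w a b, G.Step port1 u v → G.Step port2 u w → ℓ v = some a →
    ℓ w = some b → (a, b) ∈ P.pairs
  pair_next_leaf : ∀ u' v w a b, G.Step right u u' → LastPort G u v → G.Step port1 u' w →
    ℓ v = some a → ℓ w = some b → (a, b) ∈ P.pairs
  black : G.node u = .inter → P.BlackOk ((G.nbrs u).val.filterMap ℓ)

end GadgetGraph

/-- The lifted problem, on all finite graphs with the input labels above: solve the marking problem,
and solve the promise problem on the subgraph induced by the unmarked nodes. -/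
def lift {Γ : Type} (P : LinearizableProblem Γ) :
    DistributedProblem NodeKind HalfEdgeLabel (LiftOutput Γ) where
  Inst := GadgetGraph
  net := fun G => G
  Valid := fun G y => ∀ u, GadgetGraph.BadGraphRule G P.rank y u ∧
    ((y u).IsUnmarked →
      GadgetGraph.PromiseRule (G.keep {v | (y v).IsUnmarked}) P (fun v => (y v).label) u)

/-!
Below a node without errors, the layers of a gadget double in size, so gadgets without errors have
logarithmic height. Hence a node learns within `O(log n)` steps whether it has an error below it, or
above it a node that has one; exactly these nodes are marked, as up, down or error.

The unmarked nodes form octopus gadgets and inter-octopus nodes. Contracting each octopus gadget to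
the root of its head-gadget gives a virtual bipartite multigraph, an instance of `P`, in which one
edge stands for a path of length `O(log n)` in the network. The lifted algorithm runs the algorithm
for `P` on this multigraph: the first node of an octopus gadget that is processed computes the state
of the gadget, and the others copy it. To keep the number of nodes equal to `n`, all the remaining
nodes become isolated white nodes.

The step of the lifted algorithm must be a function of the view of radius `O(T(n) log n)`. Two
networks with equal views agree in a neighbourhood of the processed node, which is expressed by a
back-and-forth system of partial isomorphisms with a decreasing budget of steps. Such a system of
the networks induces one of the virtual multigraphs, hence equal views of radius `T(n)` there.
-/

namespace LabeledGraph

variable {X E : Type} {G : LabeledGraph X E} {u v : G.V}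

theorem mem_nbrs : v ∈ G.nbrs u ↔ G.graph.Adj u v := by
  simp [nbrs]

end LabeledGraph

namespace GadgetGraph

open HalfEdgeLabel

/-! ### Edges between correct nodes -/

section Edges

variable {G : GadgetGraph} {rank : ℕ} {u v w : G.V} {a : HalfEdgeLabel}

/-- What a label of the half-edge from `u` to `v` forces, by inversion of `EdgeOk`, on the opposite
half-edge and on the kinds of the endpoints. -/
def EdgeInversion (G : GadgetGraph) (u v : G.V) : HalfEdgeLabel → Prop
  | right => G.Step left v u ∧ G.node v = G.node u ∧ G.node u ≠ .inter
  | left => G.Step right v u ∧ G.node v = G.node u ∧ G.node u ≠ .inter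
  | parent => (G.Step leftChild v u ∨ G.Step rightChild v u) ∧
      G.node v = G.node u ∧ G.node u ≠ .inter
  | leftChild => G.Step parent v u ∧ G.node v = G.node u ∧ G.node u ≠ .inter
  | rightChild => G.Step parent v u ∧ G.node v = G.node u ∧ G.node u ≠ .inter
  | port1 => G.Step toHead v u ∧ G.node u = .head ∧ G.node v = .port
  | port2 => G.Step toHead v u ∧ G.node u = .head ∧ G.node v = .port
  | toHead => (G.Step port1 v u ∨ G.Step port2 v u) ∧ G.node u = .port ∧ G.node v = .head
  | toInter => G.Step toPort v u ∧ G.node u = .port ∧ G.node v = .inter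
  | toPort => G.Step toInter v u ∧ G.node u = .inter ∧ G.node v = .port

theorem edgeInversion_of_edgeOk (ha : G.graph.Adj u v)
    (h : EdgeOk (G.node u) (G.half u v) (G.half v u) (G.node v)) :
    EdgeInversion G u v (G.half u v) := by
  suffices EdgeInversion G u v (G.half u v) ∧ EdgeInversion G v u (G.half v u) from this.1
  have ha' := ha.symm
  generalize hu : G.node u = k, hv : G.node v = k', hab : G.half u v = a, hba : G.half v u = b at h
  induction h generalizing u v with
  | symm _ ih => exact (ih ha.symm ha hv hu hba hab).symm
  | _ => simp_all [EdgeInversion, LabeledGraph.Step]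

theorem Constraint.of_step (h : Constraint G rank u) (hs : G.Step a u v) :
    EdgeInversion G u v a :=
  hs.2 ▸ edgeInversion_of_edgeOk hs.1 (h.edge_ok v hs.1)

theorem Constraint.of_step_to (h : Constraint G rank v) (hs : G.Step a u v) :
    EdgeInversion G u v a :=
  hs.2 ▸ edgeInversion_of_edgeOk hs.1 (h.edge_ok u hs.1.symm).symm

theorem Constraint.step_toPort (h : Constraint G rank u) (hu : G.node u = .inter)
    (ha : G.graph.Adj u v) : G.Step toPort u v := by
  have hinv := h.of_step ⟨ha, rfl⟩
  refine ⟨ha, ?_⟩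
  cases hl : G.half u v <;> simp_all [EdgeInversion]

theorem Constraint.eq_toPort (h : Constraint G rank u) (hu : G.node u = .inter)
    (hs : G.Step a u v) : a = toPort :=
  hs.2.symm.trans (h.step_toPort hu hs.1).2

theorem Constraint.step_unique (h : Constraint G rank u) (hu : G.node u ≠ .inter)
    (hv : G.Step a u v) (hw : G.Step a u w) : v = w :=
  h.distinct hu v w hv.1 hw.1 (hv.2.trans hw.2.symm)

theorem Constraint.not_stepUp_of_inter (h : Constraint G rank u) (hu : G.node u = .inter) :
    ¬ StepUp G u v := by
  rintro (hs | hs) <;> cases h.eq_toPort hu hs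

theorem Constraint.not_stepDown_of_inter (h : Constraint G rank u) (hu : G.node u = .inter) :
    ¬ StepDown G u v := by
  rintro (hs | hs | hs | hs | hs) <;> cases h.eq_toPort hu hs

end Edges

/-! ### Descendants -/

/-- `Descendant G x l k u`: following children from `x`, the node `u` is the `k`-th node of the
`l`-th layer below `x`, counted from the left. In a graph with errors, several nodes may have the
same position, and a node several positions. -/
inductive Descendant (G : GadgetGraph) (x : G.V) : ℕ → ℕ → G.V → Prop
  | refl : Descendant G x 0 0 x
  | left {l k : ℕ} {p u : G.V} (h : Descendant G x l k p) (hs : G.Step leftChild p u) :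
      Descendant G x (l + 1) (2 * k) u
  | right {l k : ℕ} {p u : G.V} (h : Descendant G x l k p) (hs : G.Step rightChild p u) :
      Descendant G x (l + 1) (2 * k + 1) u

/-- All descendants of `x` in the layers before the `l`-th one satisfy the constraints. -/
def CleanBelow (G : GadgetGraph) (rank : ℕ) (x : G.V) (l : ℕ) : Prop :=
  ∀ j < l, ∀ k u, Descendant G x j k u → Constraint G rank u

/-- An upper bound on the number of layers of a gadget without errors. -/
noncomputable def height (G : GadgetGraph) : ℕ :=
  Nat.log 2 (Fintype.card G.V) + 1

section Descendants

variable {G : GadgetGraph} {rank : ℕ} {u v x y : G.V} {l m j k : ℕ}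

theorem CleanBelow.mono (h : CleanBelow G rank x l) (hm : m ≤ l) : CleanBelow G rank x m :=
  fun j hj => h j (hj.trans_le hm)

theorem CleanBelow.constraint (h : CleanBelow G rank x (l + 1)) (hu : Descendant G x l k u) :
    Constraint G rank u :=
  h l l.lt_succ_self k u hu

namespace Descendant

theorem eq_of_layer_zero (h : Descendant G x 0 k u) : k = 0 ∧ u = x := by
  cases h
  exact ⟨rfl, rfl⟩

theorem exists_parent (h : Descendant G x (l + 1) k u) :
    ∃ j p, Descendant G x l j p ∧
      ((k = 2 * j ∧ G.Step leftChild p u) ∨ (k = 2 * j + 1 ∧ G.Step rightChild p u)) := by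
  cases h with
  | left h hs => exact ⟨_, _, h, .inl ⟨rfl, hs⟩⟩
  | right h hs => exact ⟨_, _, h, .inr ⟨rfl, hs⟩⟩

theorem index_lt (h : Descendant G x l k u) : k < 2 ^ l := by
  induction h with
  | refl => simp
  | left _ _ ih => rw [pow_succ]; omega
  | right _ _ ih => rw [pow_succ]; omega

theorem trans (h : Descendant G x l j y) (h' : Descendant G y m k u) :
    ∃ i, Descendant G x (l + m) i u := by
  induction h' with
  | refl => exact ⟨_, h⟩
  | left _ hs ih => exact ih.elim fun _ hi => ⟨_, hi.left hs⟩
  | right _ hs ih => exact ih.elim fun _ hi => ⟨_, hi.right hs⟩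

theorem split (h : Descendant G x (l + m) k u) :
    ∃ y i j, Descendant G x l i y ∧ Descendant G y m j u := by
  induction m generalizing k u with
  | zero => exact ⟨u, k, 0, h, .refl⟩
  | succ m ih =>
    obtain ⟨j, p, hp, ⟨-, hs⟩ | ⟨-, hs⟩⟩ := exists_parent h <;>
      obtain ⟨y, i, i', hy, hpy⟩ := ih hp
    · exact ⟨y, i, _, hy, hpy.left hs⟩
    · exact ⟨y, i, _, hy, hpy.right hs⟩

theorem node_eq (h : Descendant G x l k u) (hc : CleanBelow G rank x l) :
    G.node u = G.node x := by
  induction h with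
  | refl => rfl
  | left h hs ih => exact ((hc.constraint h).of_step hs).2.1.trans (ih (hc.mono (Nat.le_succ _)))
  | right h hs ih => exact ((hc.constraint h).of_step hs).2.1.trans (ih (hc.mono (Nat.le_succ _)))

theorem step_parent (h : Descendant G x (l + 1) k u) (hc : CleanBelow G rank x (l + 1)) :
    ∃ j p, Descendant G x l j p ∧ G.Step parent u p ∧ G.node x ≠ .inter ∧
      ((k = 2 * j ∧ G.half p u = leftChild) ∨ (k = 2 * j + 1 ∧ G.half p u = rightChild)) := by
  obtain ⟨j, p, hp, hj⟩ := h.exists_parent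
  have hpx := hp.node_eq (hc.mono (Nat.le_succ l))
  rcases hj with ⟨e, hs⟩ | ⟨e, hs⟩ <;> obtain ⟨hup, -, hk⟩ := (hc.constraint hp).of_step hs
  · exact ⟨j, p, hp, hup, hpx ▸ hk, .inl ⟨e, hs.2⟩⟩
  · exact ⟨j, p, hp, hup, hpx ▸ hk, .inr ⟨e, hs.2⟩⟩

theorem node_unique (hu : Descendant G x l k u) (hv : Descendant G x l k v)
    (hc : CleanBelow G rank x l) : u = v := by
  induction l generalizing k u v with
  | zero => exact hu.eq_of_layer_zero.2.trans hv.eq_of_layer_zero.2.symm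
  | succ l ih =>
    have hc' := hc.mono (Nat.le_succ l)
    obtain ⟨-, -, -, -, hx, -⟩ := hu.step_parent hc
    obtain ⟨i, p, hp, hi⟩ := hu.exists_parent
    obtain ⟨j, q, hq, hj⟩ := hv.exists_parent
    obtain rfl : i = j := by omega
    obtain rfl := ih hp hq hc'
    have hpx : G.node p ≠ .inter := hp.node_eq hc' ▸ hx
    rcases hi with ⟨e, hs⟩ | ⟨e, hs⟩ <;> rcases hj with ⟨e', hs'⟩ | ⟨e', hs'⟩
    · exact (hc.constraint hp).step_unique hpx hs hs'
    · omega
    · omega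
    · exact (hc.constraint hp).step_unique hpx hs hs'

theorem step_right (hu : Descendant G x l k u) (hv : Descendant G x l (k + 1) v)
    (hc : CleanBelow G rank x l) : G.Step .right u v := by
  induction l generalizing k u v with
  | zero => exact absurd hv.eq_of_layer_zero.1 k.succ_ne_zero
  | succ l ih =>
    have hc' := hc.mono (Nat.le_succ l)
    obtain ⟨i, p, hp, hi⟩ := hu.exists_parent
    obtain ⟨j, q, hq, hj⟩ := hv.exists_parent
    rcases hi with ⟨e, hs⟩ | ⟨e, hs⟩ <;> rcases hj with ⟨e', hs'⟩ | ⟨e', hs'⟩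
    · omega
    · obtain rfl : i = j := by omega
      obtain rfl := hp.node_unique hq hc'
      exact (hc.constraint hp).siblings _ _ hs hs'
    · obtain rfl : j = i + 1 := by omega
      exact (hc.constraint hp).cousins _ _ _ (ih hp hq hc') hs hs'
    · omega

theorem has_leftChild_iff_of_full (hc : CleanBelow G rank x (l + 1))
    (hfull : ∀ j < 2 ^ l, ∃ v, Descendant G x l j v) (hu : Descendant G x l j u)
    (hv : Descendant G x l k v) : G.Has leftChild u ↔ G.Has leftChild v := by
  obtain ⟨w, hw⟩ := hfull 0 (by positivity)
  suffices h : ∀ j u, Descendant G x l j u → (G.Has leftChild w ↔ G.Has leftChild u) from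
    (h j u hu).symm.trans (h k v hv)
  intro j
  have hc' := hc.mono (Nat.le_succ l)
  induction j with
  | zero => exact fun u hu => by rw [hw.node_unique hu hc']
  | succ j ih =>
    intro u hu
    obtain ⟨t, ht⟩ := hfull j (by have := hu.index_lt; omega)
    exact (ih t ht).trans ((hc.constraint ht).layer_iff u (ht.step_right hu hc'))

theorem full (hu : Descendant G x l k u) (hc : CleanBelow G rank x l) (hj : j < 2 ^ l) :
    ∃ v, Descendant G x l j v := by
  induction l generalizing j k u with
  | zero =>
    obtain rfl : j = 0 := by simpa using hj
    exact ⟨x, .refl⟩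
  | succ l ih =>
    obtain ⟨i, p, hp, hi⟩ := hu.exists_parent
    have hp_child : G.Has leftChild p := by
      rcases hi with ⟨-, hs⟩ | ⟨-, hs⟩
      · exact ⟨u, hs⟩
      · exact (hc.constraint hp).children_iff.2 ⟨u, hs⟩
    have hlayer := fun j hj => ih (j := j) hp (hc.mono (Nat.le_succ l)) hj
    rw [pow_succ] at hj
    obtain ⟨q, hq⟩ := hlayer (j / 2) (by omega)
    have hq_child := (has_leftChild_iff_of_full hc hlayer hp hq).1 hp_child
    rcases Nat.mod_two_eq_zero_or_one j with h | h
    · obtain ⟨a, ha⟩ := hq_child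
      rw [show j = 2 * (j / 2) by omega]
      exact ⟨a, hq.left ha⟩
    · obtain ⟨b, hb⟩ := (hc.constraint hq).children_iff.1 hq_child
      rw [show j = 2 * (j / 2) + 1 by omega]
      exact ⟨b, hq.right hb⟩

theorem has_leftChild_iff (hu : Descendant G x l j u) (hv : Descendant G x l k v)
    (hc : CleanBelow G rank x (l + 1)) : G.Has leftChild u ↔ G.Has leftChild v :=
  has_leftChild_iff_of_full hc (fun _ => hu.full (hc.mono (Nat.le_succ l))) hu hv

theorem index_unique (hj : Descendant G x l j u) (hk : Descendant G x l k u)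
    (hc : CleanBelow G rank x (l + 1)) : j = k := by
  induction l generalizing j k u with
  | zero => exact hj.eq_of_layer_zero.1.trans hk.eq_of_layer_zero.1.symm
  | succ l ih =>
    have hc' := hc.mono (Nat.le_succ _)
    obtain ⟨i, p, hp, hup, hx, hi⟩ := hj.step_parent hc'
    obtain ⟨i', q, hq, huq, -, hi'⟩ := hk.step_parent hc'
    have hu : G.node u ≠ .inter := hj.node_eq hc' ▸ hx
    obtain rfl := (hc.constraint hj).step_unique hu hup huq
    obtain rfl := ih hp hq hc'
    rcases hi with ⟨e, h⟩ | ⟨e, h⟩ <;> rcases hi' with ⟨e', h'⟩ | ⟨e', h'⟩ <;> simp_all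

theorem two_pow_le_card (h : Descendant G x l k u) (hc : CleanBelow G rank x (l + 1)) :
    2 ^ l ≤ Fintype.card G.V := by
  choose f hf using fun j : Fin (2 ^ l) => h.full (hc.mono (Nat.le_succ l)) j.2
  have hinj : Function.Injective f := fun i j hij =>
    Fin.ext ((hf i).index_unique (hij ▸ hf j) hc)
  simpa using Fintype.card_le_of_injective f hinj

theorem lt_height (h : Descendant G x l k u) (hc : CleanBelow G rank x (l + 1)) :
    l < height G :=
  Nat.lt_succ_of_le (Nat.le_log_of_pow_le one_lt_two (h.two_pow_le_card hc))

end Descendant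
end Descendants
end GadgetGraph

/-! ### Bounded reachability -/

/-- An element that satisfies `p` is reached from the given one by at most `m` steps of `r`. Unlike
unbounded reachability, this is decided by the `m`-step neighbourhood. -/
def Within {α : Type*} (r : α → α → Prop) (p : α → Prop) : ℕ → α → Prop
  | 0, u => p u
  | m + 1, u => Within r p m u ∨ ∃ v, r u v ∧ Within r p m v

namespace Within

variable {α : Type*} {r : α → α → Prop} {p : α → Prop} {m k : ℕ} {u : α}

theorem mono (h : Within r p m u) (hk : m ≤ k) : Within r p k u := by
  induction k, hk using Nat.le_induction with
  | base => exact h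
  | succ k _ ih => exact .inl ih

theorem of_self (h : p u) : Within r p m u :=
  mono (m := 0) h (Nat.zero_le m)

theorem exists_reflTransGen (h : Within r p m u) : ∃ v, Relation.ReflTransGen r u v ∧ p v := by
  induction m generalizing u with
  | zero => exact ⟨u, .refl, h⟩
  | succ m ih =>
    obtain h | ⟨v, huv, h⟩ := h
    · exact ih h
    · obtain ⟨w, hvw, hw⟩ := ih h
      exact ⟨w, .head huv hvw, hw⟩

end Within

namespace GadgetGraph

open HalfEdgeLabel Relation

/-! ### The marked nodes -/

/-- A node that violates the constraint is reached from `u` by steps down. -/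
def ErrorBelow (G : GadgetGraph) (rank : ℕ) (u : G.V) : Prop :=
  ∃ v, ReflTransGen (StepDown G) u v ∧ ¬ Constraint G rank v

/-- The nodes that the algorithm for the lifted problem marks: by steps up, a node with an error
below it is reached. -/
def Marked (G : GadgetGraph) (rank : ℕ) (u : G.V) : Prop :=
  ∃ v, ReflTransGen (StepUp G) u v ∧ ErrorBelow G rank v

section Marked

variable {G : GadgetGraph} {rank : ℕ} {u v w x : G.V} {l k : ℕ}

theorem errorBelow_of_not_constraint (h : ¬ Constraint G rank u) : ErrorBelow G rank u :=
  ⟨u, .refl, h⟩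

theorem ErrorBelow.of_stepDown (h : ErrorBelow G rank v) (hs : StepDown G u v) :
    ErrorBelow G rank u :=
  h.imp fun _ => .imp_left (.head hs)

theorem ErrorBelow.exists_stepDown (h : ErrorBelow G rank u) (hc : Constraint G rank u) :
    ∃ v, StepDown G u v ∧ ErrorBelow G rank v := by
  obtain ⟨w, huw, hw⟩ := h
  obtain rfl | ⟨v, huv, hvw⟩ := huw.cases_head
  · exact absurd hc hw
  · exact ⟨v, huv, w, hvw, hw⟩

theorem ErrorBelow.marked (h : ErrorBelow G rank u) : Marked G rank u :=
  ⟨u, .refl, h⟩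

theorem Marked.of_stepUp (h : Marked G rank v) (hs : StepUp G u v) : Marked G rank u :=
  h.imp fun _ => .imp_left (.head hs)

theorem Marked.exists_stepUp (h : Marked G rank u) (hu : ¬ ErrorBelow G rank u) :
    ∃ v, StepUp G u v ∧ Marked G rank v := by
  obtain ⟨w, huw, hw⟩ := h
  obtain rfl | ⟨v, huv, hvw⟩ := huw.cases_head
  · exact absurd hw hu
  · exact ⟨v, huv, w, hvw, hw⟩

theorem constraint_of_not_errorBelow (h : ¬ ErrorBelow G rank u) : Constraint G rank u :=
  by_contra fun hc => h (errorBelow_of_not_constraint hc)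

theorem constraint_of_not_marked (h : ¬ Marked G rank u) : Constraint G rank u :=
  constraint_of_not_errorBelow fun hd => h hd.marked

theorem Descendant.errorBelow (h : Descendant G x l k u) (hu : ErrorBelow G rank u) :
    ErrorBelow G rank x := by
  induction h with
  | refl => exact hu
  | left _ hs ih => exact ih (hu.of_stepDown (.inl hs))
  | right _ hs ih => exact ih (hu.of_stepDown (.inr (.inl hs)))

theorem Descendant.lt_height_of_not_errorBelow (h : Descendant G x l k u)
    (hx : ¬ ErrorBelow G rank x) : l < height G :=
  h.lt_height (rank := rank) fun _ _ _ _ hv =>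
    constraint_of_not_errorBelow fun hd => hx (hv.errorBelow hd)

end Marked

/-! ### Errors are close to the nodes that they mark -/

/-- An upper bound on the number of steps down, or up, that lead from a marked node to an error. -/
noncomputable def depth (G : GadgetGraph) : ℕ :=
  2 * height G + 2

/-- A step down that leaves the gadget of `u`. -/
def StepExit (G : GadgetGraph) (u v : G.V) : Prop :=
  G.Step port1 u v ∨ G.Step port2 u v ∨ G.Step toInter u v

section Bounds

variable {G : GadgetGraph} {rank : ℕ} {u v w x : G.V} {l m k : ℕ} {p : G.V → Prop}

theorem Descendant.within_stepDown (h : Descendant G x l k u) (hu : Within (StepDown G) p m u) :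
    Within (StepDown G) p (l + m) x := by
  induction h generalizing m with
  | refl => exact hu.mono (Nat.le_add_left m 0)
  | left _ hs ih => exact (ih (m := m + 1) (.inr ⟨_, .inl hs, hu⟩)).mono (by omega)
  | right _ hs ih => exact (ih (m := m + 1) (.inr ⟨_, .inr (.inl hs), hu⟩)).mono (by omega)

theorem ErrorBelow.exists_descendant (h : ErrorBelow G rank u) :
    ∃ l k v, Descendant G u l k v ∧
      (¬ Constraint G rank v ∨ ∃ w, StepExit G v w ∧ ErrorBelow G rank w) := by
  obtain ⟨x, hux, hx⟩ := h
  induction hux using ReflTransGen.head_induction_on with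
  | refl => exact ⟨0, 0, x, .refl, .inl hx⟩
  | @head u w huw hwx ih =>
    obtain ⟨l, k, v, hv, hv'⟩ := ih
    rcases huw with hs | hs | hs
    · obtain ⟨i, hi⟩ := (Descendant.refl.left hs).trans hv
      exact ⟨_, i, v, hi, hv'⟩
    · obtain ⟨i, hi⟩ := (Descendant.refl.right hs).trans hv
      exact ⟨_, i, v, hi, hv'⟩
    · exact ⟨0, 0, u, .refl, .inr ⟨w, hs, x, hwx, hx⟩⟩

theorem ErrorBelow.exists_descendant_le_height (h : ErrorBelow G rank u) :
    ∃ l k v, Descendant G u l k v ∧ l ≤ height G ∧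
      (¬ Constraint G rank v ∨
        G.node v = G.node u ∧ ∃ w, StepExit G v w ∧ ErrorBelow G rank w) := by
  by_contra! hno
  have hclean : CleanBelow G rank u (height G + 1) := fun l hl k v hv =>
    (hno l k v hv (Nat.le_of_lt_succ hl)).1
  obtain ⟨l, k, v, hv, hv'⟩ := h.exists_descendant
  have hl : l ≤ height G := by
    by_contra! hl
    obtain ⟨d, rfl⟩ := Nat.exists_eq_add_of_lt hl
    obtain ⟨y, i, j, hy, -⟩ := Descendant.split (m := d + 1) hv
    exact (hy.lt_height hclean).false
  obtain ⟨hc, hexit⟩ := hno l k v hv hl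
  obtain ⟨w, hw, hd⟩ := hv'.resolve_left (not_not.2 hc)
  exact hexit (hv.node_eq (hclean.mono (by omega))) w hw hd

theorem ErrorBelow.not_constraint_of_inter (h : ErrorBelow G rank u) (hu : G.node u = .inter) :
    ¬ Constraint G rank u := fun hc =>
  let ⟨_, hs, _⟩ := h.exists_stepDown hc
  hc.not_stepDown_of_inter hu hs

theorem ErrorBelow.within_of_stepExit (h : ErrorBelow G rank u)
    (hexit : ∀ v w, Constraint G rank v → G.node v = G.node u → StepExit G v w →
      ErrorBelow G rank w → Within (StepDown G) (¬ Constraint G rank ·) m w) :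
    Within (StepDown G) (¬ Constraint G rank ·) (height G + (m + 1)) u := by
  obtain ⟨l, k, v, hv, hl, hv'⟩ := h.exists_descendant_le_height
  by_cases hc : Constraint G rank v
  · obtain ⟨hk, w, hs, hw⟩ := hv'.resolve_left (not_not.2 hc)
    have hvw : Within (StepDown G) (¬ Constraint G rank ·) (m + 1) v :=
      .inr ⟨w, .inr (.inr hs), hexit v w hc hk hs hw⟩
    exact (hv.within_stepDown hvw).mono (by omega)
  · exact (hv.within_stepDown (Within.of_self (m := m + 1) hc)).mono (by omega)

theorem ErrorBelow.within_of_port (h : ErrorBelow G rank u) (hu : G.node u = .port) :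
    Within (StepDown G) (¬ Constraint G rank ·) (height G + 1) u := by
  refine h.within_of_stepExit (m := 0) fun v w hv hk hs hw => hw.not_constraint_of_inter ?_
  rcases hs with hs | hs | hs <;> have := hv.of_step hs <;> simp_all [EdgeInversion]

theorem errorBelow_iff_within :
    ErrorBelow G rank u ↔ Within (StepDown G) (¬ Constraint G rank ·) (depth G) u := by
  refine ⟨fun h => ?_, Within.exists_reflTransGen⟩
  unfold depth
  cases hu : G.node u with
  | inter => exact .of_self (h.not_constraint_of_inter hu)
  | port => exact (h.within_of_port hu).mono (by omega)
  | head =>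
    refine (h.within_of_stepExit (m := height G + 1) fun v w hv hk hs hw =>
      hw.within_of_port ?_).mono (by omega)
    rcases hs with hs | hs | hs <;> have := hv.of_step hs <;> simp_all [EdgeInversion]

theorem Descendant.within_stepUp (h : Descendant G x l k u)
    (hx : Within (StepUp G) (ErrorBelow G rank) m x) :
    Within (StepUp G) (ErrorBelow G rank) (m + l) u := by
  induction h with
  | refl => exact hx
  | @left _ _ p u _ hs ih =>
    by_cases hc : Constraint G rank u
    · exact .inr ⟨p, .inl (hc.of_step_to hs).1, ih⟩
    · exact .of_self (errorBelow_of_not_constraint hc)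
  | @right _ _ p u _ hs ih =>
    by_cases hc : Constraint G rank u
    · exact .inr ⟨p, .inl (hc.of_step_to hs).1, ih⟩
    · exact .of_self (errorBelow_of_not_constraint hc)

theorem Constraint.descendant_of_step_parent (h : Constraint G rank u)
    (hs : G.Step parent u v) : ∃ k, Descendant G v 1 k u :=
  (h.of_step hs).1.elim (fun h => ⟨_, .left .refl h⟩) fun h => ⟨_, .right .refl h⟩

theorem Marked.exists_ancestor (h : Marked G rank u) :
    ∃ l x k, Descendant G x l k u ∧ (ErrorBelow G rank x ∨
      G.node x = G.node u ∧ Constraint G rank x ∧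
        ∃ w, G.Step toHead x w ∧ Marked G rank w) := by
  obtain ⟨y, huy, hy⟩ := h
  induction huy using ReflTransGen.head_induction_on with
  | refl => exact ⟨0, y, 0, .refl, .inl hy⟩
  | @head u v huv hvy ih =>
    by_cases hc : Constraint G rank u
    · rcases huv with hs | hs
      · obtain ⟨l, x, k, hx, hx'⟩ := ih
        obtain ⟨j, hj⟩ := hc.descendant_of_step_parent hs
        obtain ⟨i, hi⟩ := hx.trans hj
        exact ⟨_, x, i, hi, hx'.imp_right (.imp_left fun hk => hk.trans (hc.of_step hs).2.1)⟩
      · exact ⟨0, u, 0, .refl, .inr ⟨rfl, hc, v, hs, y, hvy, hy⟩⟩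
    · exact ⟨0, u, 0, .refl, .inl (errorBelow_of_not_constraint hc)⟩

theorem Marked.exists_ancestor_le_height (h : Marked G rank u) :
    ∃ l x k, Descendant G x l k u ∧ l ≤ height G ∧ (ErrorBelow G rank x ∨
      G.node x = G.node u ∧ Constraint G rank x ∧
        ∃ w, G.Step toHead x w ∧ Marked G rank w) := by
  obtain ⟨l, x, k, hx, hx'⟩ := h.exists_ancestor
  by_cases hl : l ≤ height G
  · exact ⟨l, x, k, hx, hl, hx'⟩
  · obtain ⟨d, rfl⟩ := Nat.exists_eq_add_of_le' (le_of_not_ge hl)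
    obtain ⟨y, -, j, -, hy⟩ := hx.split
    have hd : ErrorBelow G rank y := by
      by_contra hd
      exact (hy.lt_height_of_not_errorBelow hd).false
    exact ⟨height G, y, j, hy, le_rfl, .inl hd⟩

theorem Marked.within_of_head (h : Marked G rank u) (hu : G.node u = .head) :
    Within (StepUp G) (ErrorBelow G rank) (height G) u := by
  obtain ⟨l, x, k, hx, hl, hd | ⟨hk, hc, w, hs, -⟩⟩ := h.exists_ancestor_le_height
  · exact (hx.within_stepUp (m := 0) hd).mono (by omega)
  · have hport := (hc.of_step hs).2.1
    simp [hk, hu] at hport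

theorem marked_iff_within :
    Marked G rank u ↔ Within (StepUp G) (ErrorBelow G rank) (depth G) u := by
  refine ⟨fun h => ?_, Within.exists_reflTransGen⟩
  unfold depth
  obtain ⟨l, x, k, hx, hl, hd | ⟨-, hc, w, hs, hw⟩⟩ := h.exists_ancestor_le_height
  · exact (hx.within_stepUp (m := 0) hd).mono (by omega)
  · have hw' := hw.within_of_head (hc.of_step hs).2.2
    exact (hx.within_stepUp (m := height G + 1) (.inr ⟨w, .inr hs, hw'⟩)).mono (by omega)

end Bounds

/-! ### The neighbours of unmarked nodes -/

section Unmarked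

variable {G : GadgetGraph} {rank : ℕ} {u v w x r : G.V} {l k : ℕ}

theorem not_marked_of_stepUp (h : ¬ Marked G rank u) (hs : StepUp G u v) : ¬ Marked G rank v :=
  fun hv => h (hv.of_stepUp hs)

theorem eq_of_stepDown_of_stepUp (hu : Constraint G rank u) (hv : Constraint G rank v)
    (huv : StepDown G u v) (hvw : StepUp G v w) : w = u := by
  have hup : G.Step parent v u ∧ G.node v ≠ .inter ∨ G.Step toHead v u ∧ G.node v = .port := by
    rcases huv with hs | hs | hs | hs | hs <;> have hinv := hu.of_step hs
    · exact .inl ⟨hinv.1, hinv.2.1 ▸ hinv.2.2⟩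
    · exact .inl ⟨hinv.1, hinv.2.1 ▸ hinv.2.2⟩
    · exact .inr ⟨hinv.1, hinv.2.2⟩
    · exact .inr ⟨hinv.1, hinv.2.2⟩
    · exact absurd hvw (hv.not_stepUp_of_inter hinv.2.2)
  rcases hup with ⟨hup, hk⟩ | ⟨hup, hk⟩ <;> rcases hvw with hw | hw
  · exact hv.step_unique hk hw hup
  · exact absurd ⟨u, hup⟩ ((hv.port_root (hv.of_step hw).2.1).1 ⟨w, hw⟩)
  · exact absurd ⟨w, hw⟩ ((hv.port_root hk).1 ⟨u, hup⟩)
  · exact hv.step_unique (by simp [hk]) hw hup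

theorem not_marked_of_stepDown (h : ¬ Marked G rank u) (hs : StepDown G u v) :
    ¬ Marked G rank v := by
  intro hv
  have hd : ¬ ErrorBelow G rank v := fun hd => h (hd.of_stepDown hs).marked
  obtain ⟨w, hvw, hw⟩ := hv.exists_stepUp hd
  obtain rfl := eq_of_stepDown_of_stepUp (constraint_of_not_marked h)
    (constraint_of_not_errorBelow hd) hs hvw
  exact h hw

theorem Descendant.not_marked (h : Descendant G x l k u) (hx : ¬ Marked G rank x) :
    ¬ Marked G rank u := by
  induction h with
  | refl => exact hx
  | left _ hs ih => exact not_marked_of_stepDown ih (.inl hs)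
  | right _ hs ih => exact not_marked_of_stepDown ih (.inr (.inl hs))

theorem Descendant.ancestor_not_marked (h : Descendant G x l k u) (hu : ¬ Marked G rank u) :
    ¬ Marked G rank x := fun hx =>
  hu (h.within_stepUp (marked_iff_within.1 hx)).exists_reflTransGen

theorem cleanBelow_of_not_marked (h : ¬ Marked G rank x) (l : ℕ) : CleanBelow G rank x l :=
  fun _ _ _ _ hu => constraint_of_not_marked (hu.not_marked h)

theorem Descendant.node_eq_of_not_marked (h : Descendant G x l k u) (hx : ¬ Marked G rank x) :
    G.node u = G.node x :=
  h.node_eq (cleanBelow_of_not_marked hx l)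

theorem Descendant.lt_height_of_not_marked (h : Descendant G x l k u)
    (hx : ¬ Marked G rank x) : l < height G :=
  h.lt_height (cleanBelow_of_not_marked hx _)

theorem exists_root (hu : ¬ Marked G rank u) :
    ∃ r l k, Descendant G r l k u ∧ ¬ G.Has parent r := by
  by_contra! hno
  have hall : ∀ m, ∃ x k, Descendant G x m k u := by
    intro m
    induction m with
    | zero => exact ⟨u, 0, .refl⟩
    | succ m ih =>
      obtain ⟨x, k, hx⟩ := ih
      obtain ⟨y, hy⟩ := hno x m k hx
      obtain ⟨j, hj⟩ :=
        (constraint_of_not_marked (hx.ancestor_not_marked hu)).descendant_of_step_parent hy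
      obtain ⟨i, hi⟩ := hj.trans hx
      exact ⟨y, i, by rwa [Nat.add_comm] at hi⟩
  obtain ⟨x, k, hx⟩ := hall (height G)
  exact (hx.lt_height_of_not_marked (hx.ancestor_not_marked hu)).false

theorem Descendant.of_step_right (hu : Descendant G r l k u) (hr : ¬ G.Has parent r)
    (hm : ¬ Marked G rank r) (hs : G.Step .right u v) : Descendant G r l (k + 1) v := by
  induction l generalizing k u v with
  | zero =>
    obtain ⟨rfl, rfl⟩ := hu.eq_of_layer_zero
    exact absurd ⟨v, hs⟩ ((constraint_of_not_marked hm).root_alone hr).2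
  | succ l ih =>
    have hcu := constraint_of_not_marked (hu.not_marked hm)
    have hk : G.node u ≠ .inter := (hcu.of_step hs).2.2
    obtain ⟨j, p, hp, ⟨rfl, hpu⟩ | ⟨rfl, hpu⟩⟩ := hu.exists_parent <;>
      have hcp := constraint_of_not_marked (hp.not_marked hm)
    · obtain ⟨w, hw⟩ := hcp.children_iff.1 ⟨u, hpu⟩
      obtain rfl := hcu.step_unique hk hs (hcp.siblings _ _ hpu hw)
      exact hp.right hw
    · obtain ⟨q, hq⟩ := (hcu.right_end p hpu).1 ⟨v, hs⟩
      obtain ⟨b, hb⟩ := (hcp.layer_iff q hq).1 (hcp.children_iff.2 ⟨u, hpu⟩)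
      obtain rfl := hcu.step_unique hk hs (hcp.cousins _ _ _ hq hpu hb)
      exact (ih hp hq).left hb

theorem Descendant.of_step_left (hu : Descendant G r l k u) (hr : ¬ G.Has parent r)
    (hm : ¬ Marked G rank r) (hs : G.Step .left u v) :
    ∃ j, k = j + 1 ∧ Descendant G r l j v := by
  induction l generalizing k u v with
  | zero =>
    obtain ⟨rfl, rfl⟩ := hu.eq_of_layer_zero
    exact absurd ⟨v, hs⟩ ((constraint_of_not_marked hm).root_alone hr).1
  | succ l ih =>
    have hcu := constraint_of_not_marked (hu.not_marked hm)
    have hk : G.node u ≠ .inter := (hcu.of_step hs).2.2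
    obtain ⟨j, p, hp, ⟨rfl, hpu⟩ | ⟨rfl, hpu⟩⟩ := hu.exists_parent <;>
      have hcp := constraint_of_not_marked (hp.not_marked hm)
    · obtain ⟨q, hq⟩ := (hcu.left_end p hpu).1 ⟨v, hs⟩
      obtain ⟨i, rfl, hqi⟩ := ih hp hq
      have hcq := constraint_of_not_marked (hqi.not_marked hm)
      have hqp := (hcp.of_step hq).1
      obtain ⟨a, ha⟩ := hcq.children_iff.1 ((hcq.layer_iff p hqp).2 ⟨u, hpu⟩)
      have hau := hcq.cousins _ _ _ hqp ha hpu
      obtain rfl := hcu.step_unique hk hs (hcu.of_step_to hau).1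
      exact ⟨_, by omega, hqi.right ha⟩
    · obtain ⟨w, hw⟩ := hcp.children_iff.2 ⟨u, hpu⟩
      have hwu := hcp.siblings _ _ hw hpu
      obtain rfl := hcu.step_unique hk hs (hcu.of_step_to hwu).1
      exact ⟨_, rfl, hp.left hw⟩

theorem not_marked_of_adj (hu : ¬ Marked G rank u) (hk : G.node u ≠ .inter)
    (ha : G.graph.Adj u v) : ¬ Marked G rank v := by
  obtain ⟨r, l, k, hp, hr⟩ := exists_root hu
  have hm := hp.ancestor_not_marked hu
  have hs : G.Step (G.half u v) u v := ⟨ha, rfl⟩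
  have hinv := (constraint_of_not_marked hu).of_step hs
  generalize G.half u v = a at hs hinv
  cases a with
  | left => exact (hp.of_step_left hr hm hs).choose_spec.2.not_marked hm
  | right => exact (hp.of_step_right hr hm hs).not_marked hm
  | parent => exact not_marked_of_stepUp hu (.inl hs)
  | toHead => exact not_marked_of_stepUp hu (.inr hs)
  | leftChild => exact not_marked_of_stepDown hu (.inl hs)
  | rightChild => exact not_marked_of_stepDown hu (.inr (.inl hs))
  | port1 => exact not_marked_of_stepDown hu (.inr (.inr (.inl hs)))
  | port2 => exact not_marked_of_stepDown hu (.inr (.inr (.inr (.inl hs))))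
  | toInter => exact not_marked_of_stepDown hu (.inr (.inr (.inr (.inr hs))))
  | toPort => exact absurd hinv.2.1 hk

end Unmarked

/-! ### Validity of the marking -/

section Keep

variable {G : GadgetGraph} {rank : ℕ} {u v : G.V} {S : Set G.V} {a : HalfEdgeLabel}

theorem step_keep_iff : (G.keep S).Step a u v ↔ G.Step a u v ∧ u ∈ S ∧ v ∈ S :=
  ⟨fun h => ⟨⟨h.1.1, h.2⟩, h.1.2⟩, fun h => ⟨⟨h.1.1, h.2⟩, h.1.2⟩⟩

theorem has_keep_iff (hS : ∀ v, G.graph.Adj u v → v ∈ S) (hu : u ∈ S) :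
    (G.keep S).Has a u ↔ G.Has a u :=
  exists_congr fun v => step_keep_iff.trans (and_iff_left_of_imp fun h => ⟨hu, hS v h.1⟩)

theorem nbrs_keep_subset : (G.keep S).nbrs u ⊆ G.nbrs u := fun v hv =>
  have hadj : (G.keep S).graph.Adj u v := LabeledGraph.mem_nbrs.1 hv
  LabeledGraph.mem_nbrs.2 hadj.1

/-- The constraint survives the removal of nodes that are adjacent only to inter-octopus nodes:
an inter-octopus node merely loses neighbours. -/
theorem Constraint.keep (hS : ∀ v ∈ S, G.node v ≠ .inter → ∀ w, G.graph.Adj v w → w ∈ S)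
    (hu : u ∈ S) (hc : Constraint G rank u) : Constraint (G.keep S) rank u := by
  have has_of_ne {v} {a} (hv : v ∈ S) (hk : G.node v ≠ .inter) :
      (G.keep S).Has a v ↔ G.Has a v := has_keep_iff (hS v hv hk) hv
  have has {a} (ha : a ≠ toPort) : (G.keep S).Has a u ↔ G.Has a u := by
    by_cases hk : G.node u = .inter
    · exact iff_of_false (fun ⟨v, hv⟩ => ha (hc.eq_toPort hk (step_keep_iff.1 hv).1))
        fun ⟨v, hv⟩ => ha (hc.eq_toPort hk hv)
    · exact has_of_ne hu hk
  exact
    { edge_ok := fun v hv => hc.edge_ok v hv.1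
      distinct := fun h v w hv hw => hc.distinct h v w hv.1 hw.1
      inter_degree := fun h => (Finset.card_le_card nbrs_keep_subset).trans (hc.inter_degree h)
      children_iff := by rw [has (by simp), has (by simp), hc.children_iff]
      siblings := fun v w hv hw =>
        have hv := step_keep_iff.1 hv
        have hw := step_keep_iff.1 hw
        step_keep_iff.2 ⟨hc.siblings v w hv.1 hw.1, hv.2.2, hw.2.2⟩
      layer_iff := fun v hv => by
        obtain ⟨hs, -, hvS⟩ := step_keep_iff.1 hv
        obtain ⟨-, hk, hne⟩ := hc.of_step hs
        rw [has (by simp), has_of_ne hvS (hk ▸ hne), hc.layer_iff v hs]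
      cousins := fun v a b hv ha hb =>
        have ha := step_keep_iff.1 ha
        have hb := step_keep_iff.1 hb
        step_keep_iff.2 ⟨hc.cousins v a b (step_keep_iff.1 hv).1 ha.1 hb.1, ha.2.2, hb.2.2⟩
      root_alone := by simpa only [has, ne_eq, reduceCtorEq, not_false_eq_true] using hc.root_alone
      left_end := fun p hp => by
        obtain ⟨hs, hpS, -⟩ := step_keep_iff.1 hp
        rw [has (by simp), has_of_ne hpS (hc.of_step_to hs).2.2, hc.left_end p hs]
      right_end := fun p hp => by
        obtain ⟨hs, hpS, -⟩ := step_keep_iff.1 hp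
        rw [has (by simp), has_of_ne hpS (hc.of_step_to hs).2.2, hc.right_end p hs]
      head_port1 := fun hk => by
        simpa only [has, ne_eq, reduceCtorEq, not_false_eq_true] using hc.head_port1 hk
      head_port2 := fun hk => by
        simpa only [has, ne_eq, reduceCtorEq, not_false_eq_true] using hc.head_port2 hk
      port_root := fun hk => by
        simpa only [has, ne_eq, reduceCtorEq, not_false_eq_true] using hc.port_root hk
      port_leaf := fun hk => by
        simpa only [has, ne_eq, reduceCtorEq, not_false_eq_true] using hc.port_leaf hk }

end Keep

/-- The part of the graph that is in the family: the subgraph induced by the unmarked nodes. -/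
abbrev unmarkedGraph (G : GadgetGraph) (rank : ℕ) : GadgetGraph :=
  G.keep {v | ¬ Marked G rank v}

open Classical in
/-- The mark of `u`, with a pointer to an error below it if there is one and upwards otherwise; the
output of an unmarked node is `o`. -/
noncomputable def markOutput {Γ : Type} (G : GadgetGraph) (rank : ℕ) (u : G.V) (o : Option Γ) :
    LiftOutput Γ :=
  if ¬ Constraint G rank u then .error
  else if ErrorBelow G rank u then .down
  else if Marked G rank u then .up
  else .unmarked o

section MarkOutput

variable {G : GadgetGraph} {rank : ℕ} {u v : G.V} {a : HalfEdgeLabel} {Γ : Type}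

theorem step_unmarkedGraph_iff (hu : ¬ Marked G rank u) (hk : G.node u ≠ .inter) :
    (unmarkedGraph G rank).Step a u v ↔ G.Step a u v :=
  step_keep_iff.trans (and_iff_left_of_imp fun h => ⟨hu, not_marked_of_adj hu hk h.1⟩)

theorem has_unmarkedGraph_iff (hu : ¬ Marked G rank u) (hk : G.node u ≠ .inter) :
    (unmarkedGraph G rank).Has a u ↔ G.Has a u :=
  exists_congr fun _ => step_unmarkedGraph_iff hu hk

theorem markOutput_of_not_marked (hu : ¬ Marked G rank u) (o : Option Γ) :
    markOutput G rank u o = .unmarked o := by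
  rw [markOutput, if_neg (not_not.2 (constraint_of_not_marked hu)),
    if_neg fun hd => hu hd.marked, if_neg hu]

theorem isUnmarked_markOutput_iff {o : Option Γ} :
    (markOutput G rank u o).IsUnmarked ↔ ¬ Marked G rank u := by
  refine ⟨?_, fun hu => ⟨o, markOutput_of_not_marked hu o⟩⟩
  rintro ⟨o', h⟩ hu
  unfold markOutput at h
  split_ifs at h

theorem setOf_isUnmarked_markOutput (o : G.V → Option Γ) :
    {v | (markOutput G rank v (o v)).IsUnmarked} = {v | ¬ Marked G rank v} :=
  Set.ext fun _ => isUnmarked_markOutput_iff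

theorem ErrorBelow.markOutput_eq (h : ErrorBelow G rank u) (o : Option Γ) :
    markOutput G rank u o = .error ∨ markOutput G rank u o = .down := by
  by_cases hc : Constraint G rank u
  · exact .inr (by rw [markOutput, if_neg (not_not.2 hc), if_pos h])
  · exact .inl (if_pos hc)

theorem badGraphRule_markOutput (o : G.V → Option Γ) (u : G.V) :
    BadGraphRule G rank (fun v => markOutput G rank v (o v)) u := by
  by_cases hm : Marked G rank u
  · by_cases hc : Constraint G rank u
    · by_cases hd : ErrorBelow G rank u
      · have hu : markOutput G rank u (o u) = .down := by
          rw [markOutput, if_neg (not_not.2 hc), if_pos hd]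
        obtain ⟨v, hs, hv⟩ := hd.exists_stepDown hc
        simpa only [BadGraphRule, hu] using ⟨v, hs, hv.markOutput_eq (o v)⟩
      · have hu : markOutput G rank u (o u) = .up := by
          rw [markOutput, if_neg (not_not.2 hc), if_neg hd, if_pos hm]
        obtain ⟨v, hs, hv⟩ := hm.exists_stepUp hd
        simpa only [BadGraphRule, hu] using
          ⟨v, hs, fun h => isUnmarked_markOutput_iff.1 h hv⟩
    · have hu : markOutput G rank u (o u) = .error := if_pos hc
      simpa only [BadGraphRule, hu] using hc
  · simp only [BadGraphRule, markOutput_of_not_marked hm]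
    rw [setOf_isUnmarked_markOutput]
    exact (constraint_of_not_marked hm).keep (fun v hv hk w => not_marked_of_adj hv hk) hm

end MarkOutput

end GadgetGraph

namespace GadgetGraph

open HalfEdgeLabel

/-! ### Octopus gadgets of unmarked nodes -/

section Gadgets

variable {G : GadgetGraph} {rank : ℕ} {u v r r' : G.V} {l l' k k' : ℕ}

theorem Descendant.root_unique (h : Descendant G r l k u) (h' : Descendant G r' l' k' u)
    (hu : ¬ Marked G rank u) (hr : ¬ G.Has parent r) (hr' : ¬ G.Has parent r') :
    r = r' ∧ l = l' ∧ k = k' := by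
  have step_parent {r l k u} (h : Descendant G r (l + 1) k u) (hu : ¬ Marked G rank u) :=
    h.step_parent (cleanBelow_of_not_marked (h.ancestor_not_marked hu) _)
  induction l generalizing k l' k' u with
  | zero =>
    obtain ⟨rfl, rfl⟩ := h.eq_of_layer_zero
    cases l' with
    | zero => exact ⟨h'.eq_of_layer_zero.2, rfl, h'.eq_of_layer_zero.1.symm⟩
    | succ l' =>
      obtain ⟨-, p, -, hs, -⟩ := step_parent h' hu
      exact absurd ⟨p, hs⟩ hr
  | succ l ih =>
    obtain ⟨j, p, hp, hs, -, hj⟩ := step_parent h hu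
    cases l' with
    | zero =>
      obtain ⟨-, rfl⟩ := h'.eq_of_layer_zero
      exact absurd ⟨p, hs⟩ hr'
    | succ l' =>
      obtain ⟨j', p', hp', hs', hne, hj'⟩ := step_parent h' hu
      have hk : G.node u ≠ .inter :=
        (h'.node_eq_of_not_marked (h'.ancestor_not_marked hu)).trans_ne hne
      obtain rfl := (constraint_of_not_marked hu).step_unique hk hs hs'
      obtain ⟨rfl, rfl, rfl⟩ := ih hp hp' (not_marked_of_stepUp hu (.inl hs))
      refine ⟨rfl, rfl, ?_⟩
      rcases hj with ⟨rfl, hpu⟩ | ⟨rfl, hpu⟩ <;>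
        rcases hj' with ⟨rfl, hpu'⟩ | ⟨rfl, hpu'⟩ <;> simp_all

theorem Descendant.layer_le (hu : Descendant G r l k u) (hv : Descendant G r l' k' v)
    (hr : ¬ Marked G rank r) (hleaf : ¬ G.Has leftChild u) : l' ≤ l := by
  by_contra! hl
  obtain ⟨d, rfl⟩ := Nat.exists_eq_add_of_le hl
  obtain ⟨y, i, -, hy, -⟩ := hv.split
  obtain ⟨j, p, hp, hpy⟩ := hy.exists_parent
  refine hleaf ((hp.has_leftChild_iff hu (cleanBelow_of_not_marked hr _)).1 ?_)
  rcases hpy with ⟨-, hs⟩ | ⟨-, hs⟩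
  · exact ⟨y, hs⟩
  · exact (constraint_of_not_marked (hp.not_marked hr)).children_iff.2 ⟨y, hs⟩

theorem Descendant.layer_eq (hu : Descendant G r l k u) (hv : Descendant G r l' k' v)
    (hr : ¬ Marked G rank r) (hu' : ¬ G.Has leftChild u) (hv' : ¬ G.Has leftChild v) : l = l' :=
  (hv.layer_le hu hr hv').antisymm (hu.layer_le hv hr hu')

theorem Descendant.index_eq_zero (h : Descendant G r l k u) (hr : ¬ Marked G rank r)
    (hleft : ¬ G.Has .left u) : k = 0 := by
  have hc := cleanBelow_of_not_marked hr l
  cases k with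
  | zero => rfl
  | succ k =>
    obtain ⟨y, hy⟩ := h.full hc (j := k) (by have := h.index_lt; omega)
    exact absurd ⟨y, ((constraint_of_not_marked (h.not_marked hr)).of_step_to
      (hy.step_right h hc)).1⟩ hleft

theorem exists_leftmost_leaf (hu : ¬ Marked G rank u) :
    ∃ l x, Descendant G u l 0 x ∧ ¬ G.Has leftChild x := by
  by_contra! hno
  have hall : ∀ m, ∃ x, Descendant G u m 0 x := by
    intro m
    induction m with
    | zero => exact ⟨u, .refl⟩
    | succ m ih =>
      obtain ⟨x, hx⟩ := ih
      obtain ⟨y, hy⟩ := hno m x hx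
      exact ⟨y, hx.left hy⟩
  obtain ⟨x, hx⟩ := hall (height G)
  exact (hx.lt_height_of_not_marked hu).false

theorem not_has_leftChild_of_step_port (hu : ¬ Marked G rank u) (hk : G.node u = .head)
    (h : G.Step port1 u v ∨ G.Step port2 u v) : ¬ G.Has leftChild u := by
  have hc := constraint_of_not_marked hu
  rcases h with h | h
  · exact (hc.head_port1 hk).1 ⟨v, h⟩
  · exact hc.head_port2 hk ⟨v, h⟩

end Gadgets

/-- The root of a head-gadget that consists of unmarked nodes; it represents its octopus gadget. -/
structure OctopusRoot (G : GadgetGraph) (rank : ℕ) (r : G.V) : Prop where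
  not_marked : ¬ Marked G rank r
  head : G.node r = .head
  not_has_parent : ¬ G.Has parent r

/-- `PortWithKey G rank r κ p`: in the octopus gadget with root `r`, the node `p` is the root of the
port-gadget with key `κ`. The keys `2 * k` and `2 * k + 1` belong to the first and the second
port-gadget at the `k`-th leaf, so that port-gadgets are ordered by their keys. -/
inductive PortWithKey (G : GadgetGraph) (rank : ℕ) (r : G.V) : ℕ → G.V → Prop
  | port1 {l k : ℕ} {x p : G.V} (hr : OctopusRoot G rank r) (hx : Descendant G r l k x)
    (hs : G.Step .port1 x p) : PortWithKey G rank r (2 * k) p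
  | port2 {l k : ℕ} {x p : G.V} (hr : OctopusRoot G rank r) (hx : Descendant G r l k x)
    (hs : G.Step .port2 x p) : PortWithKey G rank r (2 * k + 1) p

/-- The number of port-gadgets to the left of the position with key `κ`. -/
noncomputable def portIndex (G : GadgetGraph) (rank : ℕ) (r : G.V) (κ : ℕ) : ℕ :=
  open Classical in Nat.count (fun κ => ∃ p, PortWithKey G rank r κ p) κ

/-- The number of port-gadgets of the octopus gadget with root `r`. -/
noncomputable def portCount (G : GadgetGraph) (rank : ℕ) (r : G.V) : ℕ :=
  portIndex G rank r (2 * Fintype.card G.V)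

/-- `p` is the root of the `i`-th port-gadget, from left to right, of the octopus gadget with root
`r`. -/
def PortRoot (G : GadgetGraph) (rank : ℕ) (r : G.V) (i : ℕ) (p : G.V) : Prop :=
  ∃ κ, PortWithKey G rank r κ p ∧ i = portIndex G rank r κ

/-- `u` belongs to the `i`-th port-gadget of the octopus gadget with root `r`. -/
def PortNode (G : GadgetGraph) (rank : ℕ) (r : G.V) (i : ℕ) (u : G.V) : Prop :=
  ∃ p l k, PortRoot G rank r i p ∧ Descendant G p l k u

/-- `u` belongs to the octopus gadget with root `r`. -/
def OctopusNode (G : GadgetGraph) (rank : ℕ) (r u : G.V) : Prop :=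
  (OctopusRoot G rank r ∧ ∃ l k, Descendant G r l k u) ∨ ∃ i, PortNode G rank r i u

/-- The `i`-th port-gadget of the octopus gadget with root `r` is attached, at its node `x`, to the
inter-octopus node `b`. -/
structure PortExit (G : GadgetGraph) (rank : ℕ) (r : G.V) (i : ℕ) (x b : G.V) : Prop where
  portNode : PortNode G rank r i x
  step : G.Step toInter x b

section Ports

variable {G : GadgetGraph} {rank : ℕ} {u v r r' p p' x x' y b b' : G.V} {i i' κ κ' l k : ℕ}

namespace PortWithKey

theorem octopusRoot (h : PortWithKey G rank r κ p) : OctopusRoot G rank r := by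
  cases h <;> assumption

theorem exists_leaf (h : PortWithKey G rank r κ p) :
    ∃ l k x, Descendant G r l k x ∧ ¬ Marked G rank x ∧ G.node x = .head ∧
      ¬ G.Has leftChild x ∧ G.Step toHead p x ∧
      ((κ = 2 * k ∧ G.Step .port1 x p) ∨ (κ = 2 * k + 1 ∧ G.Step .port2 x p)) := by
  cases h with
  | port1 hr hx hs =>
    have hm := hx.not_marked hr.not_marked
    have hk := (hx.node_eq_of_not_marked hr.not_marked).trans hr.head
    exact ⟨_, _, _, hx, hm, hk, not_has_leftChild_of_step_port hm hk (.inl hs),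
      ((constraint_of_not_marked hm).of_step hs).1, .inl ⟨rfl, hs⟩⟩
  | port2 hr hx hs =>
    have hm := hx.not_marked hr.not_marked
    have hk := (hx.node_eq_of_not_marked hr.not_marked).trans hr.head
    exact ⟨_, _, _, hx, hm, hk, not_has_leftChild_of_step_port hm hk (.inr hs),
      ((constraint_of_not_marked hm).of_step hs).1, .inr ⟨rfl, hs⟩⟩

theorem not_marked (h : PortWithKey G rank r κ p) : ¬ Marked G rank p := by
  obtain ⟨_, _, x, -, hm, hk, -, hs, -⟩ := h.exists_leaf
  exact not_marked_of_adj hm (by simp [hk]) hs.1.symm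

theorem node_eq (h : PortWithKey G rank r κ p) : G.node p = .port := by
  obtain ⟨_, _, x, -, -, -, -, hs, -⟩ := h.exists_leaf
  exact ((constraint_of_not_marked h.not_marked).of_step hs).2.1

theorem not_has_parent (h : PortWithKey G rank r κ p) : ¬ G.Has parent p := by
  obtain ⟨_, _, x, -, -, -, -, hs, -⟩ := h.exists_leaf
  exact ((constraint_of_not_marked h.not_marked).port_root h.node_eq).1 ⟨x, hs⟩

theorem lt (h : PortWithKey G rank r κ p) : κ < 2 * Fintype.card G.V := by
  obtain ⟨_, _, x, hx, -, -, -, -, hκ⟩ := h.exists_leaf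
  have := hx.index_lt
  have := hx.two_pow_le_card (cleanBelow_of_not_marked h.octopusRoot.not_marked _)
  omega

theorem root_unique (h : PortWithKey G rank r κ p) (h' : PortWithKey G rank r' κ' p) :
    r = r' ∧ κ = κ' := by
  obtain ⟨l, k, x, hx, hm, -, -, hs, hκ⟩ := h.exists_leaf
  obtain ⟨l', k', x', hx', -, -, -, hs', hκ'⟩ := h'.exists_leaf
  obtain rfl :=
    (constraint_of_not_marked h.not_marked).step_unique (by simp [h.node_eq]) hs hs'
  obtain ⟨rfl, -, rfl⟩ :=
    hx.root_unique hx' hm h.octopusRoot.not_has_parent h'.octopusRoot.not_has_parent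
  refine ⟨rfl, ?_⟩
  rcases hκ with ⟨rfl, hx⟩ | ⟨rfl, hx⟩ <;> rcases hκ' with ⟨rfl, hx'⟩ | ⟨rfl, hx'⟩ <;>
    first
      | rfl
      | cases hx.2.symm.trans hx'.2

theorem port_unique (h : PortWithKey G rank r κ p) (h' : PortWithKey G rank r κ p') :
    p = p' := by
  have hr := h.octopusRoot.not_marked
  obtain ⟨l, k, x, hx, hm, hk, hleaf, -, hκ⟩ := h.exists_leaf
  obtain ⟨l', k', x', hx', -, -, hleaf', -, hκ'⟩ := h'.exists_leaf
  obtain rfl := hx.layer_eq hx' hr hleaf hleaf'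
  obtain rfl : k = k' := by omega
  obtain rfl := hx.node_unique hx' (cleanBelow_of_not_marked hr _)
  have hne : G.node x ≠ .inter := by simp [hk]
  rcases hκ with ⟨hκ, h⟩ | ⟨hκ, h⟩ <;> rcases hκ' with ⟨hκ', h'⟩ | ⟨hκ', h'⟩ <;>
    first
      | exact (constraint_of_not_marked hm).step_unique hne h h'
      | omega

theorem portIndex_lt (h : PortWithKey G rank r κ p) (hκ : κ < κ') :
    portIndex G rank r κ < portIndex G rank r κ' := by
  classical exact Nat.count_strict_mono ⟨p, h⟩ hκ

theorem portIndex_succ (h : PortWithKey G rank r κ p) :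
    portIndex G rank r (κ + 1) = portIndex G rank r κ + 1 := by
  classical exact Nat.count_succ_eq_succ_count_iff.2 ⟨p, h⟩

end PortWithKey

theorem portIndex_succ_of_forall_not (h : ∀ p, ¬ PortWithKey G rank r κ p) :
    portIndex G rank r (κ + 1) = portIndex G rank r κ := by
  classical exact Nat.count_succ_eq_count_iff.2 (not_exists.2 h)

theorem exists_portRoot (h : i < portCount G rank r) : ∃ p, PortRoot G rank r i p := by
  classical
  have hcard (hf : (Set.ofPred fun κ => ∃ p, PortWithKey G rank r κ p).Finite) :
      i < hf.toFinset.card :=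
    lt_of_lt_of_le h (Nat.count_le_card hf _)
  obtain ⟨p, hp⟩ := Nat.nth_mem i hcard
  exact ⟨p, _, hp, (Nat.count_nth hcard).symm⟩

namespace PortRoot

theorem octopusRoot (h : PortRoot G rank r i p) : OctopusRoot G rank r :=
  h.choose_spec.1.octopusRoot

theorem not_marked (h : PortRoot G rank r i p) : ¬ Marked G rank p :=
  h.choose_spec.1.not_marked

theorem node_eq (h : PortRoot G rank r i p) : G.node p = .port :=
  h.choose_spec.1.node_eq

theorem not_has_parent (h : PortRoot G rank r i p) : ¬ G.Has parent p :=
  h.choose_spec.1.not_has_parent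

theorem lt (h : PortRoot G rank r i p) : i < portCount G rank r := by
  obtain ⟨κ, hκ, rfl⟩ := h
  exact hκ.portIndex_lt hκ.lt

theorem root_unique (h : PortRoot G rank r i p) (h' : PortRoot G rank r' i' p) :
    r = r' ∧ i = i' := by
  obtain ⟨κ, hκ, rfl⟩ := h
  obtain ⟨κ', hκ', rfl⟩ := h'
  obtain ⟨rfl, rfl⟩ := hκ.root_unique hκ'
  exact ⟨rfl, rfl⟩

theorem port_unique (h : PortRoot G rank r i p) (h' : PortRoot G rank r i p') : p = p' := by
  classical
  obtain ⟨κ, hκ, rfl⟩ := h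
  obtain ⟨κ', hκ', hi⟩ := h'
  obtain rfl := Nat.count_injective ⟨p, hκ⟩ ⟨p', hκ'⟩ hi
  exact hκ.port_unique hκ'

theorem portNode (h : PortRoot G rank r i p) : PortNode G rank r i p :=
  ⟨p, 0, 0, h, .refl⟩

end PortRoot

namespace PortNode

theorem octopusRoot (h : PortNode G rank r i u) : OctopusRoot G rank r :=
  let ⟨_, _, _, hp, _⟩ := h
  hp.octopusRoot

theorem lt (h : PortNode G rank r i u) : i < portCount G rank r :=
  let ⟨_, _, _, hp, _⟩ := h
  hp.lt

theorem not_marked (h : PortNode G rank r i u) : ¬ Marked G rank u :=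
  let ⟨_, _, _, hp, hu⟩ := h
  hu.not_marked hp.not_marked

theorem node_eq (h : PortNode G rank r i u) : G.node u = .port :=
  let ⟨_, _, _, hp, hu⟩ := h
  (hu.node_eq_of_not_marked hp.not_marked).trans hp.node_eq

theorem root_unique (h : PortNode G rank r i u) (h' : PortNode G rank r' i' u) :
    r = r' ∧ i = i' := by
  obtain ⟨p, l, k, hp, hu⟩ := id h
  obtain ⟨p', l', k', hp', hu'⟩ := h'
  obtain ⟨rfl, -, -⟩ := hu.root_unique hu' h.not_marked hp.not_has_parent hp'.not_has_parent
  exact hp.root_unique hp'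

theorem of_adj (h : PortNode G rank r i u) (ha : G.graph.Adj u v) (hv : G.node v = .port) :
    PortNode G rank r i v := by
  have hk := h.node_eq
  have hc := constraint_of_not_marked h.not_marked
  obtain ⟨p, l, k, hp, hu⟩ := h
  have hs : G.Step (G.half u v) u v := ⟨ha, rfl⟩
  have hinv := hc.of_step hs
  generalize G.half u v = a at hs hinv
  cases a with
  | left =>
    obtain ⟨j, -, hj⟩ := hu.of_step_left hp.not_has_parent hp.not_marked hs
    exact ⟨p, l, j, hp, hj⟩
  | right => exact ⟨p, l, _, hp, hu.of_step_right hp.not_has_parent hp.not_marked hs⟩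
  | leftChild => exact ⟨p, _, _, hp, hu.left hs⟩
  | rightChild => exact ⟨p, _, _, hp, hu.right hs⟩
  | parent =>
    cases l with
    | zero =>
      obtain ⟨-, rfl⟩ := hu.eq_of_layer_zero
      exact absurd ⟨v, hs⟩ hp.not_has_parent
    | succ l =>
      obtain ⟨j, q, hq, hq', -⟩ := hu.step_parent (cleanBelow_of_not_marked hp.not_marked _)
      obtain rfl := hc.step_unique (by simp [hk]) hs hq'
      exact ⟨p, l, j, hp, hq⟩
  | port1 | port2 | toHead | toInter | toPort => simp [EdgeInversion, hk, hv] at hinv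

end PortNode

namespace PortExit

theorem node_eq_inter (h : PortExit G rank r i x b) : G.node b = .inter :=
  ((constraint_of_not_marked h.portNode.not_marked).of_step h.step).2.2

theorem not_marked_inter (h : PortExit G rank r i x b) : ¬ Marked G rank b :=
  not_marked_of_adj h.portNode.not_marked (by simp [h.portNode.node_eq]) h.step.1

theorem unique (h : PortExit G rank r i x b) (h' : PortExit G rank r i x' b') :
    x = x' ∧ b = b' := by
  have hc := constraint_of_not_marked h.portNode.not_marked
  have hk := h.portNode.node_eq
  obtain ⟨hleaf, hleft⟩ := (hc.port_leaf hk).1 ⟨b, h.step⟩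
  obtain ⟨hleaf', hleft'⟩ := ((constraint_of_not_marked h'.portNode.not_marked).port_leaf
    h'.portNode.node_eq).1 ⟨b', h'.step⟩
  obtain ⟨p, l, k, hp, hx⟩ := h.portNode
  obtain ⟨p', l', k', hp', hx'⟩ := h'.portNode
  obtain rfl := hp.port_unique hp'
  obtain rfl := hx.index_eq_zero hp.not_marked hleft
  obtain rfl := hx'.index_eq_zero hp.not_marked hleft'
  obtain rfl := hx.layer_eq hx' hp.not_marked hleaf hleaf'
  obtain rfl := hx.node_unique hx' (cleanBelow_of_not_marked hp.not_marked _)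
  exact ⟨rfl, hc.step_unique (by simp [hk]) h.step h'.step⟩

end PortExit

theorem PortRoot.exists_portExit (h : PortRoot G rank r i p) :
    ∃ x b, PortExit G rank r i x b := by
  obtain ⟨l, x, hx, hleaf⟩ := exists_leftmost_leaf h.not_marked
  have hport : PortNode G rank r i x := ⟨p, l, 0, h, hx⟩
  have hleft : ¬ G.Has .left x := by
    rintro ⟨y, hy⟩
    obtain ⟨j, hj, -⟩ := hx.of_step_left h.not_has_parent h.not_marked hy
    omega
  obtain ⟨b, hb⟩ :=
    ((constraint_of_not_marked hport.not_marked).port_leaf hport.node_eq).2 ⟨hleaf, hleft⟩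
  exact ⟨x, b, hport, hb⟩

theorem OctopusNode.root_unique (h : OctopusNode G rank r u) (h' : OctopusNode G rank r' u) :
    r = r' := by
  have head_ne_port {r r' i l k} (hr : OctopusRoot G rank r) (h : Descendant G r l k u)
      (h' : PortNode G rank r' i u) : False := by
    simpa [h'.node_eq, hr.head] using h.node_eq_of_not_marked hr.not_marked
  rcases h with ⟨hr, l, k, h⟩ | ⟨i, h⟩ <;> rcases h' with ⟨hr', l', k', h'⟩ | ⟨i', h'⟩
  · exact (h.root_unique h' (h.not_marked hr.not_marked) hr.not_has_parent
      hr'.not_has_parent).1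
  · exact (head_ne_port hr h h').elim
  · exact (head_ne_port hr' h' h).elim
  · exact (h.root_unique h').1

theorem exists_octopusRoot (hu : ¬ Marked G rank u) (hk : G.node u = .head) :
    ∃ r l k, OctopusRoot G rank r ∧ Descendant G r l k u := by
  obtain ⟨r, l, k, h, hr⟩ := exists_root hu
  have hm := h.ancestor_not_marked hu
  exact ⟨r, l, k, ⟨hm, (h.node_eq_of_not_marked hm).symm.trans hk, hr⟩, h⟩

theorem exists_portNode (hu : ¬ Marked G rank u) (hk : G.node u = .port) :
    ∃ r i, PortNode G rank r i u := by
  obtain ⟨p, l, k, h, hp⟩ := exists_root hu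
  have hm := h.ancestor_not_marked hu
  have hc := constraint_of_not_marked hm
  obtain ⟨x, hx⟩ := (hc.port_root ((h.node_eq_of_not_marked hm).symm.trans hk)).2 hp
  obtain ⟨hs, -, hxk⟩ := hc.of_step hx
  obtain ⟨r, l', k', hr, hrx⟩ := exists_octopusRoot (not_marked_of_stepUp hm (.inr hx)) hxk
  rcases hs with hs | hs
  · exact ⟨r, _, p, l, k, ⟨_, .port1 hr hrx hs, rfl⟩, h⟩
  · exact ⟨r, _, p, l, k, ⟨_, .port2 hr hrx hs, rfl⟩, h⟩

/-! ### The order of the port-gadgets -/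

theorem portRoot_zero (hr : OctopusRoot G rank r) (hx : Descendant G r l k x)
    (hleft : ¬ G.Has .left x) (hs : G.Step port1 x p) : PortRoot G rank r 0 p := by
  obtain rfl := hx.index_eq_zero hr.not_marked hleft
  exact ⟨_, .port1 hr hx hs, by simp [portIndex]⟩

theorem exists_portRoot_of_lastPort (hr : OctopusRoot G rank r) (hx : Descendant G r l k x)
    (hs : LastPort G x p) :
    ∃ i, PortRoot G rank r i p ∧ portIndex G rank r (2 * k + 2) = i + 1 := by
  rcases hs with hs | ⟨hno, hs⟩
  · have hp : PortWithKey G rank r (2 * k + 1) p := .port2 hr hx hs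
    exact ⟨_, ⟨_, hp, rfl⟩, hp.portIndex_succ⟩
  · have hp : PortWithKey G rank r (2 * k) p := .port1 hr hx hs
    refine ⟨_, ⟨_, hp, rfl⟩, .trans (portIndex_succ_of_forall_not fun q hq => ?_)
      hp.portIndex_succ⟩
    have hleaf := not_has_leftChild_of_step_port (hx.not_marked hr.not_marked)
      ((hx.node_eq_of_not_marked hr.not_marked).trans hr.head) (.inl hs)
    obtain ⟨l', k', x', hx', -, -, hleaf', -, hκ⟩ := hq.exists_leaf
    obtain rfl := hx.layer_eq hx' hr.not_marked hleaf hleaf'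
    obtain ⟨hk, hs'⟩ := hκ.resolve_left (by omega)
    obtain rfl : k = k' := by omega
    obtain rfl := hx.node_unique hx' (cleanBelow_of_not_marked hr.not_marked _)
    exact hno ⟨q, hs'⟩

theorem exists_portRoot_portCount (hr : OctopusRoot G rank r) (hx : Descendant G r l k x)
    (hright : ¬ G.Has .right x) (hs : LastPort G x p) :
    ∃ i, PortRoot G rank r i p ∧ portCount G rank r = i + 1 := by
  obtain ⟨i, hi, hk⟩ := exists_portRoot_of_lastPort hr hx hs
  refine ⟨i, hi, ?_⟩
  by_contra hne
  obtain ⟨q, κ, hκ, hi'⟩ := exists_portRoot (lt_of_le_of_ne hi.lt (Ne.symm hne))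
  have hle : 2 * k + 2 ≤ κ := by
    by_contra! hlt
    have := hκ.portIndex_lt hlt
    omega
  have hleaf := not_has_leftChild_of_step_port (v := p) (hx.not_marked hr.not_marked)
    ((hx.node_eq_of_not_marked hr.not_marked).trans hr.head) (hs.elim .inr fun h => .inl h.2)
  obtain ⟨l', k', x', hx', -, -, hleaf', -, hκ'⟩ := hκ.exists_leaf
  obtain rfl := hx.layer_eq hx' hr.not_marked hleaf hleaf'
  have hc := cleanBelow_of_not_marked hr.not_marked l
  obtain ⟨y, hy⟩ := hx.full hc (j := k + 1) (by have := hx'.index_lt; omega)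
  exact hright ⟨y, hx.step_right hy hc⟩

theorem exists_portRoot_pair_of_leaf (hr : OctopusRoot G rank r) (hx : Descendant G r l k x)
    (hp : G.Step port1 x p) (hp' : G.Step port2 x p') :
    ∃ i, PortRoot G rank r i p ∧ PortRoot G rank r (i + 1) p' :=
  have h : PortWithKey G rank r (2 * k) p := .port1 hr hx hp
  ⟨_, ⟨_, h, rfl⟩, _, .port2 hr hx hp', h.portIndex_succ.symm⟩

theorem exists_portRoot_pair_of_step_right (hr : OctopusRoot G rank r)
    (hx : Descendant G r l k x) (hxy : G.Step .right x y) (hp : LastPort G x p)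
    (hp' : G.Step port1 y p') : ∃ i, PortRoot G rank r i p ∧ PortRoot G rank r (i + 1) p' := by
  obtain ⟨i, hi, hk⟩ := exists_portRoot_of_lastPort hr hx hp
  have hy := hx.of_step_right hr.not_has_parent hr.not_marked hxy
  exact ⟨i, hi, _, .port1 hr hy hp', hk.symm⟩

end Ports

/-! ### The virtual multigraph -/

section Virtual

variable {G : GadgetGraph} {rank : ℕ} {u r : G.V} {i : ℕ}

theorem exists_portExit (h : i < portCount G rank r) :
    ∃ b : {b : G.V // G.node b = .inter}, ∃ x, PortExit G rank r i x b := by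
  obtain ⟨p, hp⟩ := exists_portRoot h
  obtain ⟨x, b, hb⟩ := hp.exists_portExit
  exact ⟨⟨b, hb.node_eq_inter⟩, x, hb⟩

/-- The multigraph of the octopus gadgets. Its black nodes are the inter-octopus nodes. To have as
many nodes as `G`, it has all other nodes as white nodes: the root of an octopus gadget stands for
the octopus gadget, and the remaining white nodes are isolated. -/
noncomputable def virtualGraph (G : GadgetGraph) (rank : ℕ) : IncidenceMultigraph :=
  open Classical in
  { W := {u : G.V // G.node u ≠ .inter}
    B := {u : G.V // G.node u = .inter}
    deg := fun w => portCount G rank w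
    nbr := fun _ i => (exists_portExit i.2).choose }

theorem virtualGraph_nbr_eq_iff {w : (virtualGraph G rank).W}
    {i : Fin ((virtualGraph G rank).deg w)} {b : (virtualGraph G rank).B} :
    (virtualGraph G rank).nbr w i = b ↔ ∃ x, PortExit G rank w.1 i x b.1 := by
  have h := (exists_portExit (G := G) (rank := rank) (r := w.1) i.2).choose_spec
  refine ⟨fun hb => hb ▸ h, fun ⟨x, hx⟩ => ?_⟩
  obtain ⟨y, hy⟩ := h
  exact Subtype.ext (hy.unique hx).2

/-- A node of a head- or port-gadget as a white node of the virtual multigraph. -/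
def whiteNode (G : GadgetGraph) (rank : ℕ) (u : G.V) (h : G.node u ≠ .inter) :
    (virtualGraph G rank).W :=
  ⟨u, h⟩

/-- An inter-octopus node as a black node of the virtual multigraph. -/
def blackNode (G : GadgetGraph) (rank : ℕ) (u : G.V) (h : G.node u = .inter) :
    (virtualGraph G rank).B :=
  ⟨u, h⟩

/-- The nodes of the virtual network are those of the given one. -/
noncomputable def toNet (G : GadgetGraph) (rank : ℕ) : G.V ≃ (virtualGraph G rank).net.V :=
  open Classical in
  (Equiv.sumCompl fun u => G.node u = .inter).symm.trans (Equiv.sumComm _ _)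

theorem toNet_of_ne_inter (h : G.node u ≠ .inter) :
    toNet G rank u = .inl (whiteNode G rank u h) := by
  classical
  exact congrArg Sum.swap
    (Equiv.sumCompl_symm_apply_of_neg (p := fun u => G.node u = .inter) h)

theorem card_net : Fintype.card (virtualGraph G rank).net.V = Fintype.card G.V :=
  (Fintype.card_congr (toNet G rank)).symm

end Virtual

end GadgetGraph

/-! ### Back-and-forth systems -/

theorem map_val_eq_map_val_of_rel {α β γ : Type*} {s : Finset α} {t : Finset β}
    (Z : α → β → Prop) {f : α → γ} {g : β → γ} (forth : ∀ a ∈ s, ∃ b ∈ t, Z a b ∧ f a = g b)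
    (back : ∀ b ∈ t, ∃ a ∈ s, Z a b)
    (inj : ∀ a a' b b', Z a b → Z a' b' → (a = a' ↔ b = b')) :
    s.val.map f = t.val.map g := by
  choose i hi hZ hf using forth
  refine Multiset.map_eq_map_of_bij_of_nodup f g s.nodup t.nodup i hi ?_ ?_ hf
  · exact fun a ha a' ha' h => (inj a a' _ _ (hZ a ha) (hZ a' ha')).2 h
  · intro b hb
    obtain ⟨a, ha, hab⟩ := back b hb
    exact ⟨a, ha, (inj a a _ _ (hZ a ha) hab).1 rfl⟩

namespace LabeledGraph

variable {X E S : Type}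

/-- A back-and-forth system between two networks: `Z k u u'` means that the radius-`k`
neighbourhoods of `u` and `u'` correspond to each other. -/
structure BackForth (G G' : LabeledGraph X E) (Z : ℕ → G.V → G'.V → Prop) : Prop where
  mono : ∀ {k u u'}, Z (k + 1) u u' → Z k u u'
  forth : ∀ {k u u' w}, Z (k + 1) u u' → G.graph.Adj u w →
    ∃ w', Z k w w' ∧ G'.graph.Adj u' w' ∧ G.half u w = G'.half u' w' ∧ G.half w u = G'.half w' u'
  back : ∀ {k u u' w'}, Z (k + 1) u u' → G'.graph.Adj u' w' →
    ∃ w, Z k w w' ∧ G.graph.Adj u w ∧ G.half u w = G'.half u' w' ∧ G.half w u = G'.half w' u'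
  node : ∀ {k u u'}, Z k u u' → G.node u = G'.node u'
  inj : ∀ {u u' w w'}, Z 0 u u' → Z 0 w w' → (u = w ↔ u' = w')
  card : Fintype.card G.V = Fintype.card G'.V

namespace BackForth

variable {G G' : LabeledGraph X E} {Z : ℕ → G.V → G'.V → Prop} {k m T : ℕ} {u v w : G.V}
  {u' v' w' : G'.V}

theorem symm (B : BackForth G G' Z) : BackForth G' G fun k u' u => Z k u u' where
  mono := B.mono
  forth h ha :=
    let ⟨w, hw, ha', h₁, h₂⟩ := B.back h ha
    ⟨w, hw, ha', h₁.symm, h₂.symm⟩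
  back h ha :=
    let ⟨w, hw, ha', h₁, h₂⟩ := B.forth h ha
    ⟨w, hw, ha', h₁.symm, h₂.symm⟩
  node h := (B.node h).symm
  inj h h' := (B.inj h h').symm
  card := B.card.symm

theorem le (B : BackForth G G' Z) (h : Z m u u') (hk : k ≤ m) : Z k u u' := by
  induction m, hk using Nat.le_induction with
  | base => exact h
  | succ m _ ih => exact ih (B.mono h)

theorem adj (B : BackForth G G' Z) (hu : Z 1 u u') (hw : Z 0 w w') (ha : G.graph.Adj u w) :
    G'.graph.Adj u' w' ∧ G.half u w = G'.half u' w' := by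
  obtain ⟨x, hx, hx', hhalf, -⟩ := B.forth hu ha
  obtain rfl := (B.inj hw hx).1 rfl
  exact ⟨hx', hhalf⟩

theorem walk (B : BackForth G G' Z) (p : G.graph.Walk u w) (h : Z (k + p.length) u u') :
    ∃ w', Z k w w' ∧ ∃ p' : G'.graph.Walk u' w', p'.length = p.length := by
  induction p generalizing u' with
  | nil => exact ⟨u', h, .nil, rfl⟩
  | cons ha p ih =>
    obtain ⟨x, hx, hx', -⟩ := B.forth (k := k + p.length) h ha
    obtain ⟨w', hw', p', hp'⟩ := ih hx
    exact ⟨w', hw', .cons hx' p', by simp [hp']⟩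

theorem ball (B : BackForth G G' Z) (hv : Z (k + T) v v') (hu : G.graph.edist v u ≤ T) :
    ∃ u', Z k u u' ∧ G'.graph.edist v' u' ≤ T := by
  obtain ⟨p, hp⟩ := SimpleGraph.exists_walk_of_edist_ne_top
    (ne_top_of_le_ne_top (ENat.natCast_ne_top T) hu)
  have hpT : p.length ≤ T := by rw [← hp] at hu; exact_mod_cast hu
  obtain ⟨u', hu', p', hp'⟩ := B.walk (k := k) p (B.le hv (by omega))
  exact ⟨u', hu', (SimpleGraph.edist_le p').trans (by rw [hp']; exact_mod_cast hpT)⟩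

theorem map_half (B : BackForth G G' Z) (h : Z 1 u u') :
    (G.nbrs u).val.map (G.half u) = (G'.nbrs u').val.map (G'.half u') := by
  refine map_val_eq_map_val_of_rel (Z 0) ?_ ?_ fun a a' b b' => B.inj
  · intro w hw
    obtain ⟨w', hw', ha, hhalf, -⟩ := B.forth h (mem_nbrs.1 hw)
    exact ⟨w', mem_nbrs.2 ha, hw', hhalf⟩
  · intro w' hw'
    obtain ⟨w, hw, ha, -⟩ := B.back h (mem_nbrs.1 hw')
    exact ⟨w, mem_nbrs.2 ha, hw⟩

end BackForth

/-! ### Views -/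

section View

variable {G G' : LabeledGraph X E} {ident : G.V → ℕ} {ident' : G'.V → ℕ} {k T i j : ℕ}
  {σ : G.V → Option S} {σ' : G'.V → Option S} {u v w : G.V} {u' v' : G'.V}

theorem view_info_eq_some_iff (hi : ident.Injective) {x : X × Multiset E × Option S} :
    (G.view ident T σ v).info i = some x ↔ ∃ u, ident u = i ∧ G.graph.edist v u ≤ T ∧
      x = (G.node u, (G.nbrs u).val.map (G.half u), σ u) := by
  constructor
  · intro h
    by_cases he : ∃ u, ident u = i ∧ G.graph.edist v u ≤ T
    · exact ⟨he.choose, he.choose_spec.1, he.choose_spec.2,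
        (Option.some.inj ((dif_pos he).symm.trans h)).symm⟩
    · cases (dif_neg he).symm.trans h
  · rintro ⟨u, rfl, hu, rfl⟩
    have he : ∃ w, ident w = ident u ∧ G.graph.edist v w ≤ T := ⟨u, rfl, hu⟩
    have hw : he.choose = u := hi he.choose_spec.1
    simp only [view]
    rw [dif_pos he, hw]

theorem view_edge_eq_some_iff (hi : ident.Injective) {e : E} :
    (G.view ident T σ v).edge i j = some e ↔ ∃ u w, ident u = i ∧ ident w = j ∧
      G.graph.edist v u ≤ T ∧ G.graph.edist v w ≤ T ∧ G.graph.Adj u w ∧ e = G.half u w := by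
  constructor
  · intro h
    by_cases he : ∃ p : G.V × G.V, ident p.1 = i ∧ ident p.2 = j ∧ G.graph.edist v p.1 ≤ T ∧
      G.graph.edist v p.2 ≤ T ∧ G.graph.Adj p.1 p.2
    · obtain ⟨hi, hj, hu, hw, ha⟩ := he.choose_spec
      exact ⟨_, _, hi, hj, hu, hw, ha, (Option.some.inj ((dif_pos he).symm.trans h)).symm⟩
    · cases (dif_neg he).symm.trans h
  · rintro ⟨u, w, rfl, rfl, hu, hw, ha, rfl⟩
    have he : ∃ p : G.V × G.V, ident p.1 = ident u ∧ ident p.2 = ident w ∧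
      G.graph.edist v p.1 ≤ T ∧ G.graph.edist v p.2 ≤ T ∧ G.graph.Adj p.1 p.2 :=
      ⟨(u, w), rfl, rfl, hu, hw, ha⟩
    have hu' : he.choose.1 = u := hi he.choose_spec.1
    have hw' : he.choose.2 = w := hi he.choose_spec.2.1
    simp only [view]
    rw [dif_pos he, hu', hw']

theorem edist_add_le_of_adj (ha : G.graph.Adj u w) (h : G.graph.edist v u + (k + 1 : ℕ) ≤ T) :
    G.graph.edist v w + k ≤ T :=
  calc G.graph.edist v w + k ≤ G.graph.edist v u + G.graph.edist u w + k := by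
        gcongr
        exact G.graph.edist_triangle
    _ = G.graph.edist v u + (k + 1 : ℕ) := by
        rw [SimpleGraph.edist_eq_one_iff_adj.2 ha, add_assoc, add_comm 1, Nat.cast_succ]
    _ ≤ T := h

/-- The relation that a pair of equal radius-`T` views, of `v` and of `v'`, induces between the
nodes that these views contain together with their radius-`k` neighbourhoods. -/
structure ViewRel (G G' : LabeledGraph X E) (ident : G.V → ℕ) (ident' : G'.V → ℕ) (T : ℕ)
    (v : G.V) (v' : G'.V) (k : ℕ) (u : G.V) (u' : G'.V) : Prop where
  ident_eq : ident u = ident' u'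
  edist_left : G.graph.edist v u + k ≤ T
  edist_right : G'.graph.edist v' u' + k ≤ T

namespace ViewRel

theorem symm (h : ViewRel G G' ident ident' T v v' k u u') :
    ViewRel G' G ident' ident T v' v k u' u :=
  ⟨h.ident_eq.symm, h.edist_right, h.edist_left⟩

theorem mono (h : ViewRel G G' ident ident' T v v' (k + 1) u u') :
    ViewRel G G' ident ident' T v v' k u u' := by
  refine ⟨h.ident_eq, le_trans ?_ h.edist_left, le_trans ?_ h.edist_right⟩ <;> gcongr <;> simp

theorem forth (hi : ident.Injective) (hi' : ident'.Injective)
    (h : G.view ident T σ v = G'.view ident' T σ' v')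
    (hu : ViewRel G G' ident ident' T v v' (k + 1) u u') (ha : G.graph.Adj u w) :
    ∃ w', ViewRel G G' ident ident' T v v' k w w' ∧ G'.graph.Adj u' w' ∧
      G.half u w = G'.half u' w' ∧ G.half w u = G'.half w' u' := by
  have hw := edist_add_le_of_adj ha hu.edist_left
  have huT : G.graph.edist v u ≤ T := le_self_add.trans hu.edist_left
  have hwT : G.graph.edist v w ≤ T := le_self_add.trans hw
  have huw := (view_edge_eq_some_iff (σ := σ) hi).2 ⟨u, w, rfl, rfl, huT, hwT, ha, rfl⟩
  have hwu := (view_edge_eq_some_iff (σ := σ) hi).2 ⟨w, u, rfl, rfl, hwT, huT, ha.symm, rfl⟩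
  rw [h, view_edge_eq_some_iff hi'] at huw hwu
  obtain ⟨x, w', hx, hw', -, -, hxw, huw⟩ := huw
  obtain rfl := hi' (hx.trans hu.ident_eq)
  obtain ⟨y, z, hy, hz, -, -, -, hwu⟩ := hwu
  obtain rfl := hi' (hy.trans hw'.symm)
  obtain rfl := hi' (hz.trans hx.symm)
  exact ⟨y, ⟨hw'.symm, hw, edist_add_le_of_adj hxw hu.edist_right⟩, hxw, huw, hwu⟩

theorem info_eq (hi : ident.Injective) (hi' : ident'.Injective)
    (h : G.view ident T σ v = G'.view ident' T σ' v')
    (hu : ViewRel G G' ident ident' T v v' k u u') : G.node u = G'.node u' ∧ σ u = σ' u' := by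
  have hinfo := (view_info_eq_some_iff (σ := σ) hi).2
    ⟨u, rfl, le_self_add.trans hu.edist_left, rfl⟩
  rw [h, view_info_eq_some_iff hi'] at hinfo
  obtain ⟨w, hw, -, hinfo⟩ := hinfo
  obtain rfl := hi' (hw.trans hu.ident_eq)
  rw [Prod.mk.injEq, Prod.mk.injEq] at hinfo
  exact ⟨hinfo.1, hinfo.2.2⟩

end ViewRel

theorem backForth_of_view_eq (hi : ident.Injective) (hi' : ident'.Injective)
    (h : G.view ident T σ v = G'.view ident' T σ' v') :
    BackForth G G' (ViewRel G G' ident ident' T v v') where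
  mono := ViewRel.mono
  forth := ViewRel.forth hi hi' h
  back hu ha :=
    let ⟨w, hw, ha', h₁, h₂⟩ := ViewRel.forth hi' hi h.symm hu.symm ha
    ⟨w, hw.symm, ha', h₁.symm, h₂.symm⟩
  node hu := (hu.info_eq hi hi' h).1
  inj hu hw := by rw [← hi.eq_iff, ← hi'.eq_iff, hu.ident_eq, hw.ident_eq]
  card := congrArg View.n h

theorem viewRel_center (h : G.view ident T σ v = G'.view ident' T σ' v') :
    ViewRel G G' ident ident' T v v' T v v' :=
  ⟨congrArg View.center h, by simp, by simp⟩

namespace BackForth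

variable {Z : ℕ → G.V → G'.V → Prop}

theorem view_info (B : BackForth G G' Z) (hi : ident.Injective) (hi' : ident'.Injective)
    (hid : ∀ {k u u'}, Z k u u' → ident u = ident' u')
    (hσ : ∀ {k u u'}, Z k u u' → σ u = σ' u') (hv : Z (1 + T) v v')
    {x : X × Multiset E × Option S} (h : (G.view ident T σ v).info i = some x) :
    (G'.view ident' T σ' v').info i = some x := by
  obtain ⟨u, rfl, hu, rfl⟩ := (view_info_eq_some_iff hi).1 h
  obtain ⟨u', hu', hT⟩ := B.ball hv hu
  exact (view_info_eq_some_iff hi').2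
    ⟨u', (hid hu').symm, hT, by rw [B.node hu', B.map_half hu', hσ hu']⟩

theorem view_edge (B : BackForth G G' Z) (hi : ident.Injective) (hi' : ident'.Injective)
    (hid : ∀ {k u u'}, Z k u u' → ident u = ident' u') (hv : Z (1 + T) v v')
    {e : E} (h : (G.view ident T σ v).edge i j = some e) :
    (G'.view ident' T σ' v').edge i j = some e := by
  obtain ⟨u, w, rfl, rfl, hu, hw, ha, rfl⟩ := (view_edge_eq_some_iff hi).1 h
  obtain ⟨u', hu', huT⟩ := B.ball hv hu
  obtain ⟨w', hw', hwT⟩ := B.ball hv hw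
  obtain ⟨ha', hhalf⟩ := B.adj hu' (B.mono hw') ha
  exact (view_edge_eq_some_iff hi').2
    ⟨u', w', (hid hu').symm, (hid hw').symm, huT, hwT, ha', hhalf⟩

theorem view_eq (B : BackForth G G' Z) (hi : ident.Injective) (hi' : ident'.Injective)
    (hid : ∀ {k u u'}, Z k u u' → ident u = ident' u')
    (hσ : ∀ {k u u'}, Z k u u' → σ u = σ' u') (hv : Z (1 + T) v v') :
    G.view ident T σ v = G'.view ident' T σ' v' := by
  have hid' {k u' u} (h : Z k u u') := (hid h).symm
  have hinfo : (G.view ident T σ v).info = (G'.view ident' T σ' v').info :=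
    funext fun _ => Option.ext fun _ => ⟨B.view_info hi hi' hid hσ hv,
      B.symm.view_info hi' hi hid' (fun h => (hσ h).symm) hv⟩
  have hedge : (G.view ident T σ v).edge = (G'.view ident' T σ' v').edge :=
    funext₂ fun _ _ => Option.ext fun _ => ⟨B.view_edge hi hi' hid hv,
      B.symm.view_edge hi' hi hid' hv⟩
  have hcenter : (G.view ident T σ v).center = (G'.view ident' T σ' v').center := hid hv
  have hn : (G.view ident T σ v).n = (G'.view ident' T σ' v').n := B.card
  rcases h : G.view ident T σ v
  rcases h' : G'.view ident' T σ' v'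
  simp_all only

end BackForth

end View

end LabeledGraph

/-! ### Locality of gadgets -/

namespace GadgetGraph

/-- The radius that determines whether a node is marked. -/
noncomputable def markRadius (G : GadgetGraph) : ℕ :=
  2 * depth G + 3

/-- An upper bound on the distance between two nodes of an octopus gadget, or of an octopus gadget
and an inter-octopus node attached to it, plus the radius that determines whether a node is
marked. -/
noncomputable def span (G : GadgetGraph) : ℕ :=
  4 * depth G + 3

theorem span_eq_add (G : GadgetGraph) : span G = markRadius G + 4 * height G + 4 := by
  unfold span markRadius depth
  omega

/-- One of the two nodes is the root of an octopus gadget, the other one is the inter-octopus node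
that is attached to the `i`-th port-gadget. -/
def Joined (G : GadgetGraph) (rank : ℕ) (i : ℕ) (u v : G.V) : Prop :=
  ∃ x, PortExit G rank u i x v ∨ PortExit G rank v i x u

theorem Joined.symm {G : GadgetGraph} {rank i : ℕ} {u v : G.V} (h : Joined G rank i u v) :
    Joined G rank i v u :=
  h.imp fun _ => Or.symm

end GadgetGraph

namespace LabeledGraph.BackForth

open GadgetGraph HalfEdgeLabel

variable {G G' : GadgetGraph} {Z : ℕ → G.V → G'.V → Prop} {rank k l m n i j κ : ℕ}
  {a : HalfEdgeLabel} {u v w x r p : G.V} {u' v' w' x' r' p' : G'.V}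

theorem exists_step (B : BackForth G G' Z) (h : Z (k + 1) u u') (hs : G.Step a u w) :
    ∃ w', Z k w w' ∧ G'.Step a u' w' := by
  obtain ⟨w', hw, ha, hhalf, -⟩ := B.forth h hs.1
  exact ⟨w', hw, ha, hhalf ▸ hs.2⟩

theorem exists_step_to (B : BackForth G G' Z) (h : Z (k + 1) u u') (hs : G.Step a w u) :
    ∃ w', Z k w w' ∧ G'.Step a w' u' := by
  obtain ⟨w', hw, ha, -, hhalf⟩ := B.forth h hs.1.symm
  exact ⟨w', hw, ha.symm, hhalf ▸ hs.2⟩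

theorem step (B : BackForth G G' Z) (h : Z (k + 1) u u') (hw : Z m w w') (hs : G.Step a u w) :
    G'.Step a u' w' := by
  obtain ⟨ha, hhalf⟩ := B.adj (B.le h (by omega)) (B.le hw (by omega)) hs.1
  exact ⟨ha, hhalf ▸ hs.2⟩

theorem has (B : BackForth G G' Z) (h : Z (k + 1) u u') (ha : G.Has a u) : G'.Has a u' := by
  obtain ⟨w, hw⟩ := ha
  obtain ⟨w', -, hw'⟩ := B.exists_step h hw
  exact ⟨w', hw'⟩

theorem has_iff (B : BackForth G G' Z) (h : Z (k + 1) u u') : G.Has a u ↔ G'.Has a u' :=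
  ⟨B.has h, B.symm.has h⟩

theorem card_nbrs_eq (B : BackForth G G' Z) (h : Z 1 u u') :
    (G.nbrs u).card = (G'.nbrs u').card := by
  simpa only [Multiset.card_map, Finset.card_val] using congrArg Multiset.card (B.map_half h)

theorem constraint (B : BackForth G G' Z) (h : Z 3 u u') (hc : Constraint G rank u) :
    Constraint G' rank u' := by
  have hnode : G'.node u' = G.node u := (B.node h).symm
  have hhas {a} : G'.Has a u' ↔ G.Has a u := (B.has_iff h).symm
  refine
    { edge_ok := fun v' hv' => ?_
      distinct := fun hk v' w' hv' hw' e => ?_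
      inter_degree := fun hk => B.card_nbrs_eq (B.le h (by omega)) ▸ hc.inter_degree (hnode ▸ hk)
      children_iff := by simpa only [hhas] using hc.children_iff
      siblings := fun v' w' hv' hw' => ?_
      layer_iff := fun v' hv' => ?_
      cousins := fun v' y' z' hv' hy' hz' => ?_
      root_alone := by simpa only [hhas] using hc.root_alone
      left_end := fun q' hq' => ?_
      right_end := fun q' hq' => ?_
      head_port1 := by simpa only [hnode, hhas] using hc.head_port1
      head_port2 := by simpa only [hnode, hhas] using hc.head_port2
      port_root := by simpa only [hnode, hhas] using hc.port_root
      port_leaf := by simpa only [hnode, hhas] using hc.port_leaf }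
  · obtain ⟨v, hv, ha, huv, hvu⟩ := B.back h hv'
    simpa only [hnode, ← huv, ← hvu, ← B.node hv] using hc.edge_ok v ha
  · obtain ⟨v, hv, hav, huv, -⟩ := B.back h hv'
    obtain ⟨w, hw, haw, huw, -⟩ := B.back h hw'
    exact (B.inj (B.le hv (by omega)) (B.le hw (by omega))).1
      (hc.distinct (hnode ▸ hk) v w hav haw (huv.trans (e.trans huw.symm)))
  · obtain ⟨v, hv, hsv⟩ := B.symm.exists_step h hv'
    obtain ⟨w, hw, hsw⟩ := B.symm.exists_step h hw'
    exact B.step hv hw (hc.siblings v w hsv hsw)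
  · obtain ⟨v, hv, hs⟩ := B.symm.exists_step h hv'
    exact hhas.trans ((hc.layer_iff v hs).trans (B.has_iff hv))
  · obtain ⟨v, hv, hsv⟩ := B.symm.exists_step h hv'
    obtain ⟨y, hy, hsy⟩ := B.symm.exists_step h hy'
    obtain ⟨z, hz, hsz⟩ := B.symm.exists_step hv hz'
    exact B.step hy hz (hc.cousins v y z hsv hsy hsz)
  · obtain ⟨q, hq, hs⟩ := B.symm.exists_step_to h hq'
    exact hhas.trans ((hc.left_end q hs).trans (B.has_iff hq))
  · obtain ⟨q, hq, hs⟩ := B.symm.exists_step_to h hq'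
    exact hhas.trans ((hc.right_end q hs).trans (B.has_iff hq))

theorem constraint_iff (B : BackForth G G' Z) (h : Z 3 u u') :
    Constraint G rank u ↔ Constraint G' rank u' :=
  ⟨B.constraint h, B.symm.constraint h⟩

theorem exists_stepUp (B : BackForth G G' Z) (h : Z (k + 1) u u') (hs : StepUp G u v) :
    ∃ v', Z k v v' ∧ StepUp G' u' v' :=
  hs.elim (fun hs => (B.exists_step h hs).imp fun _ => .imp_right .inl)
    fun hs => (B.exists_step h hs).imp fun _ => .imp_right .inr

theorem exists_stepDown (B : BackForth G G' Z) (h : Z (k + 1) u u') (hs : StepDown G u v) :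
    ∃ v', Z k v v' ∧ StepDown G' u' v' := by
  have ha : G.graph.Adj u v := by
    rcases hs with h | h | h | h | h <;> exact h.1
  obtain ⟨v', hv, ha', hhalf, -⟩ := B.forth h ha
  exact ⟨v', hv, by simpa only [StepDown, Step, ← hhalf, ha', ha, true_and] using hs⟩

theorem within (B : BackForth G G' Z) {s : G.V → G.V → Prop} {s' : G'.V → G'.V → Prop}
    {q : G.V → Prop} {q' : G'.V → Prop}
    (hs : ∀ {k u u' v}, Z (k + 1) u u' → s u v → ∃ v', Z k v v' ∧ s' u' v')
    (hq : ∀ {u u'}, Z n u u' → q u → q' u') (h : Z (n + m) u u') (hu : Within s q m u) :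
    Within s' q' m u' := by
  induction m generalizing u u' with
  | zero => exact hq h hu
  | succ m ih =>
    obtain hu | ⟨v, huv, hv⟩ := hu
    · exact .inl (ih (B.mono h) hu)
    · obtain ⟨v', hv', huv'⟩ := hs h huv
      exact .inr ⟨v', huv', ih hv' hv⟩

theorem height_eq (B : BackForth G G' Z) : height G = height G' := by
  rw [height, height, B.card]

theorem depth_eq (B : BackForth G G' Z) : depth G = depth G' := by
  rw [depth, depth, B.height_eq]

theorem markRadius_eq (B : BackForth G G' Z) : markRadius G = markRadius G' := by
  rw [markRadius, markRadius, B.depth_eq]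

theorem span_eq (B : BackForth G G' Z) : span G = span G' := by
  rw [span, span, B.depth_eq]

theorem errorBelow (B : BackForth G G' Z) (h : Z (3 + depth G) u u')
    (hu : ErrorBelow G rank u) : ErrorBelow G' rank u' := by
  rw [errorBelow_iff_within] at hu ⊢
  rw [← B.depth_eq]
  exact B.within B.exists_stepDown (fun h hv hc => hv (B.symm.constraint h hc)) h hu

theorem errorBelow_iff (B : BackForth G G' Z) (h : Z (3 + depth G) u u') :
    ErrorBelow G rank u ↔ ErrorBelow G' rank u' :=
  ⟨B.errorBelow h, B.symm.errorBelow (B.depth_eq ▸ h)⟩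

theorem marked (B : BackForth G G' Z) (h : Z k u u') (hk : markRadius G ≤ k)
    (hu : Marked G rank u) : Marked G' rank u' := by
  rw [marked_iff_within] at hu ⊢
  rw [← B.depth_eq]
  exact B.within B.exists_stepUp B.errorBelow (B.le h (by unfold markRadius at hk; omega)) hu

theorem marked_iff (B : BackForth G G' Z) (h : Z k u u') (hk : markRadius G ≤ k) :
    Marked G rank u ↔ Marked G' rank u' :=
  ⟨B.marked h hk, B.symm.marked h (B.markRadius_eq ▸ hk)⟩

theorem markOutput_eq (B : BackForth G G' Z) (h : Z k u u') (hk : markRadius G ≤ k)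
    {Γ : Type} (o : Option Γ) : markOutput G rank u o = markOutput G' rank u' o := by
  have hd := hk
  unfold markRadius at hd
  have hc := B.constraint_iff (rank := rank) (B.le h (m := k) (by omega))
  have he := B.errorBelow_iff (rank := rank) (B.le h (m := k) (by omega))
  classical
  exact if_congr (not_congr hc) rfl (if_congr he rfl (if_congr (B.marked_iff h hk) rfl rfl))

theorem exists_descendant (B : BackForth G G' Z) (h : Z (k + l) x x')
    (hu : Descendant G x l j u) : ∃ u', Z k u u' ∧ Descendant G' x' l j u' := by
  induction hu generalizing k with
  | refl => exact ⟨x', h, .refl⟩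
  | @left l _ _ _ _ hs ih =>
    obtain ⟨p', hp, hpx⟩ := ih (k := k + 1) (B.le h (by omega))
    obtain ⟨u', hu, hs'⟩ := B.exists_step hp hs
    exact ⟨u', hu, hpx.left hs'⟩
  | @right l _ _ _ _ hs ih =>
    obtain ⟨p', hp, hpx⟩ := ih (k := k + 1) (B.le h (by omega))
    obtain ⟨u', hu, hs'⟩ := B.exists_step hp hs
    exact ⟨u', hu, hpx.right hs'⟩

theorem exists_descendant_to (B : BackForth G G' Z) (h : Z (k + l) u u')
    (hu : Descendant G x l j u) : ∃ x', Z k x x' ∧ Descendant G' x' l j u' := by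
  induction hu generalizing u' with
  | refl => exact ⟨u', h, .refl⟩
  | left _ hs ih =>
    obtain ⟨p', hp, hs'⟩ := B.exists_step_to h hs
    obtain ⟨x', hx, hpx⟩ := ih hp
    exact ⟨x', hx, hpx.left hs'⟩
  | right _ hs ih =>
    obtain ⟨p', hp, hs'⟩ := B.exists_step_to h hs
    obtain ⟨x', hx, hpx⟩ := ih hp
    exact ⟨x', hx, hpx.right hs'⟩

theorem octopusRoot (B : BackForth G G' Z) (h : Z k r r') (hk : markRadius G ≤ k)
    (hr : OctopusRoot G rank r) : OctopusRoot G' rank r' where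
  not_marked := (B.marked_iff h hk).not.1 hr.not_marked
  head := (B.node h).symm.trans hr.head
  not_has_parent :=
    (B.has_iff (B.le (m := k) h (by unfold markRadius at hk; omega) : Z (0 + 1) r r')).not.1
      hr.not_has_parent

theorem exists_portWithKey (B : BackForth G G' Z) (h : Z (k + height G + markRadius G) r r')
    (hp : PortWithKey G rank r κ p) : ∃ p', Z k p p' ∧ PortWithKey G' rank r' κ p' := by
  have hr' := B.octopusRoot h (by omega) hp.octopusRoot
  cases hp with
  | port1 hr hx hs =>
    have hl := hx.lt_height_of_not_marked hr.not_marked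
    obtain ⟨x', hxx, hx'⟩ := B.exists_descendant (k := k + 1) (B.le h (by omega)) hx
    obtain ⟨p', hp, hs'⟩ := B.exists_step hxx hs
    exact ⟨p', hp, .port1 hr' hx' hs'⟩
  | port2 hr hx hs =>
    have hl := hx.lt_height_of_not_marked hr.not_marked
    obtain ⟨x', hxx, hx'⟩ := B.exists_descendant (k := k + 1) (B.le h (by omega)) hx
    obtain ⟨p', hp, hs'⟩ := B.exists_step hxx hs
    exact ⟨p', hp, .port2 hr' hx' hs'⟩

theorem exists_portWithKey_to (B : BackForth G G' Z) (h : Z (k + height G) p p')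
    (hk : markRadius G ≤ k) (hp : PortWithKey G rank r κ p) :
    ∃ r', Z k r r' ∧ PortWithKey G' rank r' κ p' := by
  cases hp with
  | @port1 l _ _ _ hr hx hs =>
    have hl := hx.lt_height_of_not_marked hr.not_marked
    obtain ⟨x', hxx, hs'⟩ := B.exists_step_to (k := k + l) (B.le h (by omega)) hs
    obtain ⟨r', hrr, hx'⟩ := B.exists_descendant_to hxx hx
    exact ⟨r', hrr, .port1 (B.octopusRoot hrr hk hr) hx' hs'⟩
  | @port2 l _ _ _ hr hx hs =>
    have hl := hx.lt_height_of_not_marked hr.not_marked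
    obtain ⟨x', hxx, hs'⟩ := B.exists_step_to (k := k + l) (B.le h (by omega)) hs
    obtain ⟨r', hrr, hx'⟩ := B.exists_descendant_to hxx hx
    exact ⟨r', hrr, .port2 (B.octopusRoot hrr hk hr) hx' hs'⟩

theorem portIndex_eq (B : BackForth G G' Z) (h : Z (k + height G + markRadius G) r r') :
    portIndex G rank r = portIndex G' rank r' := by
  have h' := h
  rw [B.height_eq, B.markRadius_eq] at h'
  have hkey (κ) : (∃ p, PortWithKey G rank r κ p) ↔ ∃ p, PortWithKey G' rank r' κ p :=
    ⟨fun ⟨_, hp⟩ => (B.exists_portWithKey h hp).imp fun _ => And.right,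
      fun ⟨_, hp⟩ => (B.symm.exists_portWithKey h' hp).imp fun _ => And.right⟩
  funext κ
  simp only [portIndex, Nat.count_eq_card_filter_range]
  exact congrArg Finset.card (Finset.ext fun κ => by simp only [Finset.mem_filter, hkey])

theorem exists_portRoot (B : BackForth G G' Z) (h : Z (k + height G + markRadius G) r r')
    (hp : PortRoot G rank r i p) : ∃ p', Z k p p' ∧ PortRoot G' rank r' i p' := by
  obtain ⟨κ, hκ, rfl⟩ := hp
  obtain ⟨p', hp, hκ'⟩ := B.exists_portWithKey h hκ
  exact ⟨p', hp, κ, hκ', by rw [B.portIndex_eq h]⟩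

theorem exists_portRoot_to (B : BackForth G G' Z) (h : Z (k + 2 * height G + markRadius G) p p')
    (hp : PortRoot G rank r i p) : ∃ r', Z k r r' ∧ PortRoot G' rank r' i p' := by
  obtain ⟨κ, hκ, rfl⟩ := hp
  obtain ⟨r', hr, hκ'⟩ := B.exists_portWithKey_to (k := k + height G + markRadius G)
    (B.le h (by omega)) (by omega) hκ
  exact ⟨r', B.le hr (by omega), κ, hκ', by rw [B.portIndex_eq hr]⟩

theorem exists_portNode (B : BackForth G G' Z) (h : Z (k + 2 * height G + markRadius G) r r')
    (hu : PortNode G rank r i u) : ∃ u', Z k u u' ∧ PortNode G' rank r' i u' := by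
  obtain ⟨p, l, j, hp, hpu⟩ := hu
  have hl := hpu.lt_height_of_not_marked hp.not_marked
  obtain ⟨p', hpp, hp'⟩ := B.exists_portRoot (k := k + l) (B.le h (by omega)) hp
  obtain ⟨u', huu, hpu'⟩ := B.exists_descendant hpp hpu
  exact ⟨u', huu, p', l, j, hp', hpu'⟩

theorem exists_portNode_to (B : BackForth G G' Z) (h : Z (k + 3 * height G + markRadius G) u u')
    (hu : PortNode G rank r i u) : ∃ r', Z k r r' ∧ PortNode G' rank r' i u' := by
  obtain ⟨p, l, j, hp, hpu⟩ := hu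
  have hl := hpu.lt_height_of_not_marked hp.not_marked
  obtain ⟨p', hpp, hpu'⟩ := B.exists_descendant_to (k := k + 2 * height G + markRadius G)
    (B.le h (by omega)) hpu
  obtain ⟨r', hrr, hp'⟩ := B.exists_portRoot_to hpp hp
  exact ⟨r', hrr, p', l, j, hp', hpu'⟩

theorem exists_octopusNode (B : BackForth G G' Z) (h : Z (k + span G) r r')
    (hu : OctopusNode G rank r u) : ∃ u', Z k u u' ∧ OctopusNode G' rank r' u' := by
  rw [span_eq_add] at h
  obtain ⟨hr, l, j, hru⟩ | ⟨i, hi⟩ := hu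
  · have hl := hru.lt_height_of_not_marked hr.not_marked
    obtain ⟨u', huu, hru'⟩ := B.exists_descendant (k := k) (B.le h (by omega)) hru
    exact ⟨u', huu, .inl ⟨B.octopusRoot h (by omega) hr, l, j, hru'⟩⟩
  · obtain ⟨u', huu, hi'⟩ := B.exists_portNode (k := k) (B.le h (by omega)) hi
    exact ⟨u', huu, .inr ⟨i, hi'⟩⟩

theorem exists_octopusNode_to (B : BackForth G G' Z) (h : Z (k + span G) u u')
    (hu : OctopusNode G rank r u) : ∃ r', Z k r r' ∧ OctopusNode G' rank r' u' := by
  rw [span_eq_add] at h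
  obtain ⟨hr, l, j, hru⟩ | ⟨i, hi⟩ := hu
  · have hl := hru.lt_height_of_not_marked hr.not_marked
    obtain ⟨r', hrr, hru'⟩ := B.exists_descendant_to (k := k + markRadius G)
      (B.le h (by omega)) hru
    exact ⟨r', B.le hrr (by omega), .inl ⟨B.octopusRoot hrr (by omega) hr, l, j, hru'⟩⟩
  · obtain ⟨r', hrr, hi'⟩ := B.exists_portNode_to (k := k) (B.le h (by omega)) hi
    exact ⟨r', hrr, .inr ⟨i, hi'⟩⟩

theorem exists_joined (B : BackForth G G' Z) (h : Z (k + span G) u u')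
    (hu : Joined G rank i u v) : ∃ v', Z k v v' ∧ Joined G' rank i u' v' := by
  rw [span_eq_add] at h
  obtain ⟨x, ⟨hp, hs⟩ | ⟨hp, hs⟩⟩ := hu
  · obtain ⟨x', hx, hp'⟩ := B.exists_portNode (k := k + 1) (B.le h (by omega)) hp
    obtain ⟨v', hv, hs'⟩ := B.exists_step hx hs
    exact ⟨v', hv, x', .inl ⟨hp', hs'⟩⟩
  · obtain ⟨x', hx, hs'⟩ := B.exists_step_to (k := k + 3 * height G + markRadius G)
      (B.le h (by omega)) hs
    obtain ⟨v', hv, hp'⟩ := B.exists_portNode_to hx hp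
    exact ⟨v', hv, x', .inr ⟨hp', hs'⟩⟩

theorem joined (B : BackForth G G' Z) (h : Z (k + span G) u u') (hv : Z m v v')
    (hu : Joined G rank i u v) : Joined G' rank i u' v' := by
  obtain ⟨w, hw, h'⟩ := B.exists_joined h hu
  obtain rfl := (B.inj (B.le hv (by omega)) (B.le hw (by omega))).1 rfl
  exact h'

theorem joined_iff (B : BackForth G G' Z) (h : Z (k + span G) u u') (hv : Z m v v') :
    Joined G rank i u v ↔ Joined G' rank i u' v' :=
  ⟨B.joined h hv, B.symm.joined (B.span_eq ▸ h) hv⟩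

end LabeledGraph.BackForth

/-! ### Locality of the virtual network -/

namespace GadgetGraph

open LabeledGraph

section Net

variable {G : GadgetGraph} {rank i : ℕ} {u v : G.V}

theorem Joined.node_eq_inter_iff (h : Joined G rank i u v) :
    G.node u = .inter ↔ G.node v ≠ .inter := by
  obtain ⟨x, hx | hx⟩ := h <;> simp [hx.node_eq_inter, hx.portNode.octopusRoot.head]

theorem exists_nbr_eq_iff {w : (virtualGraph G rank).W} {b : (virtualGraph G rank).B} :
    (∃ h : i < (virtualGraph G rank).deg w, (virtualGraph G rank).nbr w ⟨i, h⟩ = b) ↔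
      Joined G rank i w.1 b.1 := by
  constructor
  · rintro ⟨h, hb⟩
    obtain ⟨x, hx⟩ := virtualGraph_nbr_eq_iff.1 hb
    exact ⟨x, .inl hx⟩
  · rintro ⟨x, hx | hx⟩
    · exact ⟨hx.portNode.lt, virtualGraph_nbr_eq_iff.2 ⟨x, hx⟩⟩
    · exact absurd hx.node_eq_inter w.2

theorem mem_positions_iff {w : (virtualGraph G rank).W} {b : (virtualGraph G rank).B} :
    i ∈ (virtualGraph G rank).positions w b ↔ Joined G rank i w.1 b.1 := by
  rw [← exists_nbr_eq_iff]
  simp only [IncidenceMultigraph.positions, Finset.mem_map, Finset.mem_filter, Finset.mem_univ,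
    true_and, Fin.valEmbedding_apply, Fin.exists_iff, exists_and_right, exists_eq_right]

theorem net_adj_inl_inr_iff {w : (virtualGraph G rank).W} {b : (virtualGraph G rank).B} :
    (virtualGraph G rank).net.graph.Adj (.inl w) (.inr b) ↔ ∃ i, Joined G rank i w.1 b.1 := by
  simp only [← exists_nbr_eq_iff, IncidenceMultigraph.net, SimpleGraph.fromRel_adj]
  constructor
  · rintro ⟨-, ⟨w', i, hw, hb⟩ | ⟨w', i, hw, -⟩⟩
    · obtain rfl := Sum.inl.inj hw
      exact ⟨i, i.2, (Sum.inr.inj hb).symm⟩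
    · exact absurd hw Sum.inr_ne_inl
  · rintro ⟨i, h, rfl⟩
    exact ⟨Sum.inl_ne_inr, .inl ⟨w, _, rfl, rfl⟩⟩

theorem net_adj_iff {x y : (virtualGraph G rank).net.V} :
    (virtualGraph G rank).net.graph.Adj x y ↔
      ∃ i, Joined G rank i ((toNet G rank).symm x) ((toNet G rank).symm y) := by
  rcases x with w | b <;> rcases y with w' | b'
  · refine iff_of_false (by simp [IncidenceMultigraph.net]) ?_
    rintro ⟨i, h⟩
    exact w.2 (h.node_eq_inter_iff.2 w'.2)
  · exact net_adj_inl_inr_iff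
  · exact (SimpleGraph.adj_comm _ _ _).trans
      (net_adj_inl_inr_iff.trans (exists_congr fun _ => ⟨Joined.symm, Joined.symm⟩))
  · refine iff_of_false (by simp [IncidenceMultigraph.net]) ?_
    rintro ⟨i, h⟩
    exact h.node_eq_inter_iff.1 b.2 b'.2

theorem mem_net_half_iff {x y : (virtualGraph G rank).net.V} :
    i ∈ (virtualGraph G rank).net.half x y ↔
      Joined G rank i ((toNet G rank).symm x) ((toNet G rank).symm y) := by
  rcases x with w | b <;> rcases y with w' | b'
  · exact iff_of_false (Finset.notMem_empty i) fun h => w.2 (h.node_eq_inter_iff.2 w'.2)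
  · exact mem_positions_iff
  · exact mem_positions_iff.trans ⟨Joined.symm, Joined.symm⟩
  · exact iff_of_false (Finset.notMem_empty i) fun h => h.node_eq_inter_iff.1 b.2 b'.2

open Classical in
theorem net_node_eq (x : (virtualGraph G rank).net.V) :
    (virtualGraph G rank).net.node x =
      if G.node ((toNet G rank).symm x) = .inter then .black else .white := by
  rcases x with w | b
  · exact (if_neg w.2).symm
  · exact (if_pos b.2).symm

end Net

section NetRel

variable {G G' : GadgetGraph} {Z : ℕ → G.V → G'.V → Prop} {rank k : ℕ}
  {x y : (virtualGraph G rank).net.V} {x' : (virtualGraph G' rank).net.V}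

/-- The back-and-forth system between virtual networks that is induced by one between gadget
graphs: a step in the virtual network is a walk of length at most `span G` in the gadget graph. -/
def NetRel (G G' : GadgetGraph) (rank : ℕ) (Z : ℕ → G.V → G'.V → Prop) (k : ℕ)
    (x : (virtualGraph G rank).net.V) (x' : (virtualGraph G' rank).net.V) : Prop :=
  Z (span G * k + span G) ((toNet G rank).symm x) ((toNet G' rank).symm x')

theorem netRel_symm_iff (B : BackForth G G' Z) :
    NetRel G' G rank (fun k u' u => Z k u u') k x' x ↔ NetRel G G' rank Z k x x' := by
  rw [NetRel, NetRel, B.span_eq]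

theorem NetRel.forth (B : BackForth G G' Z) (h : NetRel G G' rank Z (k + 1) x x')
    (ha : (virtualGraph G rank).net.graph.Adj x y) :
    ∃ y', NetRel G G' rank Z k y y' ∧ (virtualGraph G' rank).net.graph.Adj x' y' ∧
      (virtualGraph G rank).net.half x y = (virtualGraph G' rank).net.half x' y' ∧
      (virtualGraph G rank).net.half y x = (virtualGraph G' rank).net.half y' x' := by
  rw [NetRel, mul_add, mul_one] at h
  obtain ⟨i, hi⟩ := net_adj_iff.1 ha
  obtain ⟨v', hv, hi'⟩ := B.exists_joined h hi
  obtain ⟨y', rfl⟩ := (toNet G' rank).symm.surjective v'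
  refine ⟨y', hv, net_adj_iff.2 ⟨i, hi'⟩, ?_, ?_⟩ <;> ext j <;>
    rw [mem_net_half_iff, mem_net_half_iff]
  · exact B.joined_iff h hv
  · exact ⟨fun hj => (B.joined h hv hj.symm).symm,
      fun hj => (B.symm.joined (B.span_eq ▸ h) hv hj.symm).symm⟩

theorem backForth_net (B : BackForth G G' Z) :
    BackForth (virtualGraph G rank).net (virtualGraph G' rank).net (NetRel G G' rank Z) where
  mono h := B.le h (by rw [mul_add]; omega)
  forth := NetRel.forth B
  back {k x x' y'} h ha := by
    obtain ⟨y, hy, ha', h₁, h₂⟩ := NetRel.forth B.symm ((netRel_symm_iff B).2 h) ha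
    exact ⟨y, (netRel_symm_iff B).1 hy, ha', h₁.symm, h₂.symm⟩
  node h := by rw [net_node_eq, net_node_eq, B.node h]
  inj h h' := by
    rw [← (toNet G rank).symm.injective.eq_iff, ← (toNet G' rank).symm.injective.eq_iff]
    exact B.inj (B.le h (Nat.zero_le _)) (B.le h' (Nat.zero_le _))
  card := by rw [card_net, card_net, B.card]

end NetRel

end GadgetGraph

/-! ### Runs of SLOCAL algorithms -/

open Classical in
/-- An element of `s`, if there is any. -/
noncomputable def pick {α : Type*} (s : Set α) : Option α :=
  if h : s.Nonempty then some h.choose else none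

theorem pick_eq {α : Type*} {s : Set α} {o : Option α} (h : ∀ a, a ∈ s ↔ o = some a) :
    pick s = o := by
  by_cases hs : s.Nonempty
  · rw [pick, dif_pos hs, (h _).1 hs.choose_spec]
  · rw [pick, dif_neg hs]
    exact (Option.eq_none_iff_forall_ne_some.2 fun a ha => hs ⟨a, (h a).2 ha⟩).symm

section FirstOccurrences

variable {α : Type*} {l : List α} {a : α}

open Classical in
/-- The list without repetitions that lists the elements of `l` in the order of their first
occurrences. -/
noncomputable def firstOccurrences (l : List α) : List α :=
  l.reverse.dedup.reverse

theorem nodup_firstOccurrences (l : List α) : (firstOccurrences l).Nodup := by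
  classical
  exact List.nodup_reverse.2 (List.nodup_dedup _)

theorem mem_firstOccurrences : a ∈ firstOccurrences l ↔ a ∈ l := by
  simp [firstOccurrences]

theorem firstOccurrences_concat_of_mem (h : a ∈ l) :
    firstOccurrences (l ++ [a]) = firstOccurrences l := by
  simp [firstOccurrences, List.dedup_cons_of_mem, h]

theorem firstOccurrences_concat_of_notMem (h : a ∉ l) :
    firstOccurrences (l ++ [a]) = firstOccurrences l ++ [a] := by
  simp [firstOccurrences, List.dedup_cons_of_notMem, h]

end FirstOccurrences

namespace SLOCALAlgorithm

variable {X E Y : Type} (A : SLOCALAlgorithm X E Y) (G : LabeledGraph X E) (ident : G.V → ℕ)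
  (T : ℕ) {l l' : List G.V} {v : G.V}

open Classical in
theorem run_concat (l : List G.V) (v : G.V) :
    A.run G ident T (l ++ [v]) = Function.update (A.run G ident T l) v
      (some (A.step (G.view ident T (A.run G ident T l) v))) := by
  simp [run, List.foldl_append]

theorem run_append_of_notMem (l : List G.V) (hv : v ∉ l') :
    A.run G ident T (l ++ l') v = A.run G ident T l v := by
  classical
  induction l' using List.reverseRecOn with
  | nil => rw [List.append_nil]
  | append_singleton l' w ih =>
    simp only [List.mem_append, List.mem_singleton, not_or] at hv
    rw [← List.append_assoc, run_concat, Function.update_of_ne hv.2, ih hv.1]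

theorem isSome_run : (A.run G ident T l v).isSome ↔ v ∈ l := by
  classical
  induction l using List.reverseRecOn with
  | nil => simp [run]
  | append_singleton l w ih =>
    rw [run_concat]
    by_cases h : v = w
    · simp [h]
    · simp [ih, h]

theorem run_eq_none_iff : A.run G ident T l v = none ↔ v ∉ l := by
  rw [← Option.not_isSome_iff_eq_none, isSome_run]

theorem exists_run_eq_some (hv : v ∈ l) : ∃ s, A.run G ident T l v = some s :=
  Option.isSome_iff_exists.1 ((A.isSome_run G ident T).2 hv)

open Classical in
theorem run_firstOccurrences_concat (l : List G.V) (v : G.V) :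
    A.run G ident T (firstOccurrences (l ++ [v])) =
      Function.update (A.run G ident T (firstOccurrences l)) v
        (some ((A.run G ident T (firstOccurrences l) v).getD
          (A.step (G.view ident T (A.run G ident T (firstOccurrences l)) v)))) := by
  by_cases hv : v ∈ l
  · obtain ⟨s, hs⟩ := A.exists_run_eq_some G ident T (mem_firstOccurrences.2 hv)
    rw [firstOccurrences_concat_of_mem hv, hs, Option.getD_some, ← hs, Function.update_eq_self]
  · have hnone := (A.run_eq_none_iff G ident T).2 (mt mem_firstOccurrences.1 hv)
    rw [firstOccurrences_concat_of_notMem hv, run_concat, hnone, Option.getD_none]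

end SLOCALAlgorithm

/-! ### The simulation -/

namespace GadgetGraph

open HalfEdgeLabel LabeledGraph

section Simulation

variable {G : GadgetGraph} {rank i : ℕ} {u v r x : G.V} {S Y Γ : Type}

open Classical in
/-- The node that represents `u`: the root of the octopus gadget of `u` or, if `u` is not in such a
gadget, the node `u` itself. -/
noncomputable def rep (G : GadgetGraph) (rank : ℕ) (u : G.V) : G.V :=
  if h : ∃ r, OctopusNode G rank r u then h.choose else u

theorem rep_eq_iff : rep G rank u = x ↔
    OctopusNode G rank x u ∨ ((∀ r, ¬ OctopusNode G rank r u) ∧ u = x) := by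
  by_cases h : ∃ r, OctopusNode G rank r u
  · rw [rep, dif_pos h]
    constructor
    · rintro rfl
      exact .inl h.choose_spec
    · rintro (hx | ⟨hno, -⟩)
      · exact h.choose_spec.root_unique hx
      · exact absurd h.choose_spec (hno _)
  · rw [rep, dif_neg h]
    push Not at h
    simp [h]

/-- The virtual node to which `u` belongs. -/
noncomputable def virtualNode (G : GadgetGraph) (rank : ℕ) (u : G.V) :
    (virtualGraph G rank).net.V :=
  toNet G rank (rep G rank u)

theorem PortNode.virtualNode_eq (h : PortNode G rank r i u) :
    virtualNode G rank u = toNet G rank r :=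
  congrArg _ (rep_eq_iff.2 (.inl (.inr ⟨i, h⟩)))

/-- The index of the port-gadget to which `u` belongs. -/
noncomputable def portNumber (G : GadgetGraph) (rank : ℕ) (u : G.V) : Option ℕ :=
  pick {i | ∃ r, PortNode G rank r i u}

theorem PortNode.portNumber_eq (h : PortNode G rank r i u) : portNumber G rank u = some i :=
  pick_eq fun _ => ⟨fun ⟨_, hj⟩ => congrArg some (h.root_unique hj).2,
    fun hj => ⟨r, Option.some.inj hj ▸ h⟩⟩

theorem portNumber_eq_none (h : G.node u ≠ .port) : portNumber G rank u = none :=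
  pick_eq fun _ => ⟨fun ⟨_, hi⟩ => absurd hi.node_eq h, nofun⟩

/-- The states of the virtual nodes, as stored in the states of the nodes. -/
noncomputable def virtualState (G : GadgetGraph) (rank : ℕ) (σ : G.V → Option (S × Y))
    (x : (virtualGraph G rank).net.V) : Option S :=
  pick {s | ∃ u y, virtualNode G rank u = x ∧ σ u = some (s, y)}

/-- The output of `v` when `ℓ` is the output of its virtual node: if `v` is unmarked and belongs to
the `i`-th port-gadget, it outputs the label `ℓ i`. -/
noncomputable def nodeOutput (G : GadgetGraph) (rank : ℕ) (v : G.V) (ℓ : ℕ → Γ) : LiftOutput Γ :=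
  markOutput G rank v ((portNumber G rank v).map ℓ)

variable (A : SLOCALAlgorithm Color (Finset ℕ) (ℕ → Γ))

/-- The new state of the virtual node of `v` when `v` is processed: it is computed when the first
node of this virtual node is processed, and then copied. -/
noncomputable def nextState (G : GadgetGraph) (rank T : ℕ) (ident : G.V → ℕ)
    (σ : G.V → Option (A.State × Y)) (v : G.V) : A.State :=
  (virtualState G rank σ (virtualNode G rank v)).getD
    (A.step ((virtualGraph G rank).net.view (ident ∘ (toNet G rank).symm) T
      (virtualState G rank σ) (virtualNode G rank v)))

end Simulation

end GadgetGraph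

namespace LabeledGraph.BackForth

open GadgetGraph

section Simulation

variable {G G' : GadgetGraph} {Z : ℕ → G.V → G'.V → Prop} {rank k T : ℕ} {u v x r : G.V}
  {u' v' x' r' : G'.V} {S Y Γ : Type} {σ : G.V → Option (S × Y)} {σ' : G'.V → Option (S × Y)}

theorem not_octopusNode (B : BackForth G G' Z) (h : Z (k + span G) u u')
    (hu : ∀ r, ¬ OctopusNode G rank r u) : ¬ OctopusNode G' rank r' u' := fun h' =>
  let ⟨r, _, hr⟩ := B.symm.exists_octopusNode_to (B.span_eq ▸ h) h'
  hu r hr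

theorem rep (B : BackForth G G' Z) (h : Z (k + span G) u u') :
    Z k (rep G rank u) (rep G' rank u') := by
  rcases rep_eq_iff.1 (rfl : GadgetGraph.rep G rank u = _) with hr | ⟨hno, hu⟩
  · obtain ⟨r', hrr, hr'⟩ := B.exists_octopusNode_to h hr
    rwa [rep_eq_iff.2 (.inl hr')]
  · rw [rep_eq_iff.2 (.inr ⟨fun _ => B.not_octopusNode h hno, rfl⟩), ← hu]
    exact B.le h (Nat.le_add_right _ _)

theorem exists_rep_eq (B : BackForth G G' Z) (h : Z (k + span G) x x')
    (hu : GadgetGraph.rep G rank u = x) : ∃ u', Z k u u' ∧ GadgetGraph.rep G' rank u' = x' := by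
  rcases rep_eq_iff.1 hu with hr | ⟨hno, rfl⟩
  · obtain ⟨u', huu, hr'⟩ := B.exists_octopusNode h hr
    exact ⟨u', huu, rep_eq_iff.2 (.inl hr')⟩
  · exact ⟨x', B.le h (Nat.le_add_right _ _),
      rep_eq_iff.2 (.inr ⟨fun _ => B.not_octopusNode h hno, rfl⟩)⟩

theorem netRel_virtualNode (B : BackForth G G' Z) (h : Z (span G * (k + 2)) u u') :
    NetRel G G' rank Z k (virtualNode G rank u) (virtualNode G' rank u') := by
  rw [NetRel, virtualNode, virtualNode, Equiv.symm_apply_apply, Equiv.symm_apply_apply]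
  exact B.rep (B.le h (by rw [mul_add]; omega))

theorem exists_virtualNode_eq (B : BackForth G G' Z) {y : (virtualGraph G rank).net.V}
    {y' : (virtualGraph G' rank).net.V} (h : NetRel G G' rank Z k y y')
    (hu : virtualNode G rank u = y) :
    ∃ u', Z (span G * k) u u' ∧ virtualNode G' rank u' = y' := by
  obtain ⟨u', huu, hu'⟩ := B.exists_rep_eq h ((Equiv.eq_symm_apply _).2 hu)
  exact ⟨u', huu, (Equiv.eq_symm_apply _).1 hu'⟩

theorem portNumber_eq (B : BackForth G G' Z) (h : Z (k + span G) u u') :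
    portNumber G rank u = portNumber G' rank u' := by
  have hk : k + 3 * height G + markRadius G ≤ k + span G := by
    rw [span_eq_add]
    omega
  have h' := B.le h hk
  have h'' := h'
  rw [B.height_eq, B.markRadius_eq] at h''
  refine congrArg pick (Set.ext fun i => ⟨fun ⟨_, hi⟩ => ?_, fun ⟨_, hi⟩ => ?_⟩)
  · exact (B.exists_portNode_to h' hi).imp fun _ => And.right
  · exact (B.symm.exists_portNode_to h'' hi).imp fun _ => And.right

theorem virtualState_eq (B : BackForth G G' Z) (hσ : ∀ {k u u'}, Z k u u' → σ u = σ' u')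
    {y : (virtualGraph G rank).net.V} {y' : (virtualGraph G' rank).net.V}
    (h : NetRel G G' rank Z k y y') : virtualState G rank σ y = virtualState G' rank σ' y' := by
  refine congrArg pick (Set.ext fun s => ⟨fun ⟨u, o, hu, hs⟩ => ?_, fun ⟨u', o, hu, hs⟩ => ?_⟩)
  · obtain ⟨u', huu, hu'⟩ := B.exists_virtualNode_eq h hu
    exact ⟨u', o, hu', (hσ huu).symm.trans hs⟩
  · obtain ⟨u, huu, hu'⟩ := B.symm.exists_virtualNode_eq ((netRel_symm_iff B).2 h) hu
    exact ⟨u, o, hu', (hσ huu).trans hs⟩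

theorem nodeOutput_eq (B : BackForth G G' Z) (h : Z (k + span G) v v') (ℓ : ℕ → Γ) :
    nodeOutput G rank v ℓ = nodeOutput G' rank v' ℓ := by
  rw [nodeOutput, nodeOutput, B.portNumber_eq h,
    B.markOutput_eq h (by rw [span_eq_add]; omega)]

variable (A : SLOCALAlgorithm Color (Finset ℕ) (ℕ → Γ))

theorem nextState_eq (B : BackForth G G' Z) {ident : G.V → ℕ} {ident' : G'.V → ℕ}
    (hi : ident.Injective) (hi' : ident'.Injective)
    (hid : ∀ {k u u'}, Z k u u' → ident u = ident' u')
    {σ : G.V → Option (A.State × Y)} {σ' : G'.V → Option (A.State × Y)}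
    (hσ : ∀ {k u u'}, Z k u u' → σ u = σ' u') (h : Z (span G * (T + 3)) v v') :
    nextState A G rank T ident σ v = nextState A G' rank T ident' σ' v' := by
  have hv : NetRel G G' rank Z (1 + T) (virtualNode G rank v) (virtualNode G' rank v') :=
    B.netRel_virtualNode (by rwa [show 1 + T + 2 = T + 3 by omega])
  have hview := (backForth_net B).view_eq (hi.comp (toNet G rank).symm.injective)
    (hi'.comp (toNet G' rank).symm.injective) (fun h => hid h)
    (fun h => B.virtualState_eq hσ h) hv
  rw [nextState, nextState, B.virtualState_eq hσ hv, hview]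

end Simulation

end LabeledGraph.BackForth

namespace GadgetGraph

open LabeledGraph

/-- The radius of the queries of the simulation: the simulated queries of radius `T n` span at most
`T n + 3` octopus gadgets, whose diameters are logarithmic. -/
noncomputable def radius (T : ℕ → ℕ) (n : ℕ) : ℕ :=
  (4 * (2 * (Nat.log 2 n + 1) + 2) + 3) * (T n + 3)

theorem radius_card (G : GadgetGraph) (T : ℕ → ℕ) :
    radius T (Fintype.card G.V) = span G * (T (Fintype.card G.V) + 3) :=
  rfl

/-- A situation during the execution of an algorithm: the node `v` is about to be processed. -/
structure Configuration (S : Type) where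
  G : GadgetGraph
  ident : G.V → ℕ
  injective : ident.Injective
  σ : G.V → Option S
  v : G.V

namespace Configuration

variable {S Γ : Type} (A : SLOCALAlgorithm Color (Finset ℕ) (ℕ → Γ)) (rank : ℕ) (T : ℕ → ℕ)

/-- What the processed node sees. -/
noncomputable def view (C : Configuration S) : View NodeKind HalfEdgeLabel S :=
  C.G.view C.ident (radius T (Fintype.card C.G.V)) C.σ C.v

/-- The new state of the processed node in the simulation of `A`, which consists of the state of
its virtual node and its output. -/
noncomputable def next (C : Configuration (A.State × LiftOutput Γ)) : A.State × LiftOutput Γ :=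
  let s := nextState A C.G rank (T (Fintype.card C.G.V)) C.ident C.σ C.v
  (s, nodeOutput C.G rank C.v (A.output s))

theorem next_factorsThrough_view : (next A rank T).FactorsThrough (view T) := by
  rintro ⟨G, ident, hi, σ, v⟩ ⟨G', ident', hi', σ', v'⟩ h
  simp only [view] at h
  have hcard : Fintype.card G.V = Fintype.card G'.V := congrArg View.n h
  rw [← hcard] at h
  have B := backForth_of_view_eq hi hi' h
  have hv := viewRel_center h
  rw [radius_card] at h B hv
  have hs := B.nextState_eq A (rank := rank) hi hi' (fun hu => hu.ident_eq)
    (fun hu => (hu.info_eq hi hi' h).2) hv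
  have ho := B.nodeOutput_eq (Γ := Γ) (rank := rank) (k := 0)
    (B.le hv (by rw [zero_add]; exact Nat.le_mul_of_pos_right _ (by omega)))
  simp only [next, ← hcard, hs, ho]

end Configuration

section LiftAlgorithm

variable {Γ : Type} (A : SLOCALAlgorithm Color (Finset ℕ) (ℕ → Γ)) (rank : ℕ) (T : ℕ → ℕ)

/-- The algorithm for the lifted problem that simulates `A`. Its step is well defined since the next
state depends only on the view; views that do not occur are mapped to an arbitrary state. -/
noncomputable def liftAlgorithm : SLOCALAlgorithm NodeKind HalfEdgeLabel (LiftOutput Γ) where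
  State := A.State × LiftOutput Γ
  step := Function.extend (Configuration.view T) (Configuration.next A rank T)
    fun _ => (A.step ⟨0, 0, fun _ => none, fun _ _ => none⟩, .error)
  output := Prod.snd

theorem liftAlgorithm_step (C : Configuration (A.State × LiftOutput Γ)) :
    (liftAlgorithm A rank T).step (C.view T) = C.next A rank T := by
  simp only [liftAlgorithm, (Configuration.next_factorsThrough_view A rank T).extend_apply]

variable (G : GadgetGraph) (ident : G.V → ℕ)

/-- The states of the virtual nodes after `A` has processed the virtual nodes of the nodes of
`order`, in the order of their first occurrences. -/
noncomputable def virtualRun (order : List G.V) : (virtualGraph G rank).net.V → Option A.State :=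
  A.run (virtualGraph G rank).net (ident ∘ (toNet G rank).symm) (T (Fintype.card G.V))
    (firstOccurrences (order.map (virtualNode G rank)))

variable {G ident rank} {order : List G.V} {u v : G.V}

theorem exists_virtualRun_eq_some (hu : u ∈ order) :
    ∃ s, virtualRun A rank T G ident order (virtualNode G rank u) = some s :=
  A.exists_run_eq_some _ _ _ (mem_firstOccurrences.2 (List.mem_map_of_mem hu))

theorem virtualState_run
    (h : ∀ u ∈ order, (liftAlgorithm A rank T).run G ident (radius T (Fintype.card G.V)) order u =
      (virtualRun A rank T G ident order (virtualNode G rank u)).map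
        fun s => (s, nodeOutput G rank u (A.output s))) :
    virtualState G rank
        ((liftAlgorithm A rank T).run G ident (radius T (Fintype.card G.V)) order) =
      virtualRun A rank T G ident order := by
  refine funext fun x => pick_eq fun s => ⟨?_, fun hs => ?_⟩
  · rintro ⟨u, y, rfl, hu⟩
    have hmem : u ∈ order :=
      ((liftAlgorithm A rank T).isSome_run G ident _).1 (Option.isSome_of_eq_some hu)
    rw [h u hmem, Option.map_eq_some_iff] at hu
    obtain ⟨t, ht, hts⟩ := hu
    rw [ht]
    exact congrArg (some ∘ Prod.fst) hts
  · have hx := (A.isSome_run _ _ _).1 (Option.isSome_of_eq_some hs)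
    obtain ⟨u, hu, rfl⟩ := List.mem_map.1 (mem_firstOccurrences.1 hx)
    exact ⟨u, _, rfl, by rw [h u hu, hs, Option.map_some]⟩

open Classical in
theorem virtualRun_concat (order : List G.V) (v : G.V) :
    virtualRun A rank T G ident (order ++ [v]) =
      Function.update (virtualRun A rank T G ident order) (virtualNode G rank v)
        (some ((virtualRun A rank T G ident order (virtualNode G rank v)).getD
          (A.step ((virtualGraph G rank).net.view (ident ∘ (toNet G rank).symm)
            (T (Fintype.card G.V)) (virtualRun A rank T G ident order)
            (virtualNode G rank v))))) := by
  rw [virtualRun, List.map_append]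
  exact A.run_firstOccurrences_concat _ _ _ _ _

theorem virtualRun_concat_of_mem (hu : u ∈ order) :
    virtualRun A rank T G ident (order ++ [v]) (virtualNode G rank u) =
      virtualRun A rank T G ident order (virtualNode G rank u) := by
  classical
  obtain ⟨s, hs⟩ := exists_virtualRun_eq_some A T hu
  rw [virtualRun_concat]
  by_cases huv : virtualNode G rank u = virtualNode G rank v
  · rw [← huv, Function.update_self, hs, Option.getD_some]
  · rw [Function.update_of_ne huv]

theorem run_liftAlgorithm (hi : ident.Injective) (horder : order.Nodup) (hu : u ∈ order) :
    (liftAlgorithm A rank T).run G ident (radius T (Fintype.card G.V)) order u =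
      (virtualRun A rank T G ident order (virtualNode G rank u)).map
        fun s => (s, nodeOutput G rank u (A.output s)) := by
  classical
  induction order using List.reverseRecOn generalizing u with
  | nil => simp at hu
  | append_singleton order v ih =>
    have ih' {u} := ih (u := u) (horder.of_append_left)
    have hstep := liftAlgorithm_step A rank T ⟨G, ident, hi,
      (liftAlgorithm A rank T).run G ident (radius T (Fintype.card G.V)) order, v⟩
    simp only [Configuration.view, Configuration.next, nextState,
      virtualState_run A T fun _ => ih'] at hstep
    rw [SLOCALAlgorithm.run_concat]
    obtain hmem | rfl := (List.mem_append.1 hu).imp_right List.mem_singleton.1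
    · have huv : u ≠ v := by
        rintro rfl
        exact List.disjoint_of_nodup_append horder hmem (List.mem_singleton_self u)
      rw [Function.update_of_ne huv, ih' hmem, virtualRun_concat_of_mem A T hmem]
    · rw [Function.update_self, hstep, virtualRun_concat, Function.update_self, Option.map_some]
      rfl

end LiftAlgorithm

end GadgetGraph

/-! ### Validity of the simulated outputs -/

namespace GadgetGraph

open HalfEdgeLabel

section VirtualBlack

variable {G : GadgetGraph} {rank : ℕ} {u x : G.V}

theorem mem_edgesAt_blackNode_iff {hk : G.node u = .inter}
    {e : Σ w : (virtualGraph G rank).W, Fin ((virtualGraph G rank).deg w)} :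
    e ∈ (virtualGraph G rank).edgesAt (blackNode G rank u hk) ↔
      ∃ x, PortExit G rank e.1.1 e.2 x u := by
  simp only [IncidenceMultigraph.edgesAt, Finset.mem_filter, Finset.mem_univ, true_and]
  exact virtualGraph_nbr_eq_iff

theorem exists_portExit_of_adj (hu : ¬ Marked G rank u) (hk : G.node u = .inter)
    (hx : ¬ Marked G rank x) (ha : G.graph.Adj u x) : ∃ r i, PortExit G rank r i x u := by
  have hc := constraint_of_not_marked hu
  obtain ⟨hs, -, hport⟩ := hc.of_step (hc.step_toPort hk ha)
  obtain ⟨r, i, hr⟩ := exists_portNode hx hport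
  exact ⟨r, i, hr, hs⟩

theorem map_nbrs_unmarkedGraph {α : Type*} (hu : ¬ Marked G rank u) (hk : G.node u = .inter)
    {f : G.V → α} {g : (Σ w : (virtualGraph G rank).W, Fin ((virtualGraph G rank).deg w)) → α}
    (hfg : ∀ x e, PortExit G rank e.1.1 e.2 x u → f x = g e) :
    ((unmarkedGraph G rank).nbrs u).val.map f =
      ((virtualGraph G rank).edgesAt (blackNode G rank u hk)).val.map g := by
  refine map_val_eq_map_val_of_rel (fun (x : G.V) e => PortExit G rank e.1.1 e.2 x u) ?_ ?_ ?_
  · intro x hx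
    obtain ⟨ha, -, hx⟩ := LabeledGraph.mem_nbrs.1 hx
    obtain ⟨r, i, h⟩ := exists_portExit_of_adj hu hk hx ha
    have hr : G.node r ≠ .inter := by simp [h.portNode.octopusRoot.head]
    exact ⟨⟨whiteNode G rank r hr, i, h.portNode.lt⟩, mem_edgesAt_blackNode_iff.2 ⟨x, h⟩, h,
      hfg x _ h⟩
  · intro e he
    obtain ⟨x, hx⟩ := mem_edgesAt_blackNode_iff.1 he
    exact ⟨x, LabeledGraph.mem_nbrs.2 ⟨hx.step.1.symm, hu, hx.portNode.not_marked⟩, hx⟩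
  · rintro x x' ⟨⟨r, hr⟩, ⟨i, hi⟩⟩ ⟨⟨r', hr'⟩, ⟨i', hi'⟩⟩ h h'
    refine ⟨?_, fun he => ?_⟩
    · rintro rfl
      obtain ⟨rfl : r = r', rfl : i = i'⟩ := h.portNode.root_unique h'.portNode
      rfl
    · rw [← he] at h'
      exact (h.unique h').1

theorem card_edgesAt_le (b : (virtualGraph G rank).B) :
    ((virtualGraph G rank).edgesAt b).card ≤ rank := by
  obtain ⟨u, hk⟩ := b
  by_cases hu : Marked G rank u
  · rw [Finset.card_eq_zero.2 (Finset.eq_empty_of_forall_notMem fun e he => ?_)]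
    · exact rank.zero_le
    · obtain ⟨x, hx⟩ := (mem_edgesAt_blackNode_iff (hk := hk)).1 he
      exact hx.not_marked_inter hu
  · have h := congrArg Multiset.card
      (map_nbrs_unmarkedGraph hu hk (f := fun _ => ()) (g := fun _ => ()) fun _ _ _ => rfl)
    calc ((virtualGraph G rank).edgesAt _).card
        = ((unmarkedGraph G rank).nbrs u).card :=
          (Multiset.card_map _ _).symm.trans (h.symm.trans (Multiset.card_map _ _))
      _ ≤ (LabeledGraph.nbrs G u).card := Finset.card_le_card nbrs_keep_subset
      _ ≤ rank := (constraint_of_not_marked hu).inter_degree hk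

end VirtualBlack

section LiftOutput

variable {G : GadgetGraph} {rank i : ℕ} {u v w p r x : G.V} {Γ : Type} {a b : Γ}
  {P : LinearizableProblem Γ} {y : (virtualGraph G rank).net.V → ℕ → Γ}

/-- The output for the lifted problem that is obtained from one for the virtual network. -/
noncomputable def liftOutput (G : GadgetGraph) (rank : ℕ)
    (y : (virtualGraph G rank).net.V → ℕ → Γ) (u : G.V) : LiftOutput Γ :=
  nodeOutput G rank u (y (virtualNode G rank u))

theorem isUnmarked_liftOutput_iff : (liftOutput G rank y u).IsUnmarked ↔ ¬ Marked G rank u :=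
  isUnmarked_markOutput_iff

theorem label_liftOutput (hu : ¬ Marked G rank u) :
    (liftOutput G rank y u).label = (portNumber G rank u).map (y (virtualNode G rank u)) := by
  rw [liftOutput, nodeOutput, markOutput_of_not_marked hu]
  rfl

theorem PortNode.label_liftOutput (h : PortNode G rank r i u) :
    (liftOutput G rank y u).label = some (y (toNet G rank r) i) := by
  rw [GadgetGraph.label_liftOutput h.not_marked, h.portNumber_eq, h.virtualNode_eq,
    Option.map_some]

theorem PortRoot.label_liftOutput (h : PortRoot G rank r i p) :
    (liftOutput G rank y p).label = some (y (toNet G rank r) i) :=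
  h.portNode.label_liftOutput

theorem isSome_label_liftOutput_iff (hu : ¬ Marked G rank u) :
    (liftOutput G rank y u).label.isSome ↔ G.node u = .port := by
  refine ⟨fun h => ?_, fun hk => ?_⟩
  · by_contra hk
    rw [label_liftOutput hu, portNumber_eq_none hk] at h
    cases h
  · obtain ⟨r, i, hr⟩ := exists_portNode hu hk
    rw [hr.label_liftOutput, Option.isSome_some]

theorem label_liftOutput_eq_of_adj (hu : ¬ Marked G rank u) (ha : G.graph.Adj u v)
    (hk : G.node u = .port) (hk' : G.node v = .port) :
    (liftOutput G rank y u).label = (liftOutput G rank y v).label := by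
  obtain ⟨r, i, hr⟩ := exists_portNode hu hk
  exact hr.label_liftOutput.trans (hr.of_adj ha hk').label_liftOutput.symm

theorem filterMap_label_liftOutput (hu : ¬ Marked G rank u) (hk : G.node u = .inter) :
    ((unmarkedGraph G rank).nbrs u).val.filterMap (fun x => (liftOutput G rank y x).label) =
      ((virtualGraph G rank).edgesAt (blackNode G rank u hk)).val.map
        fun e => y (.inl e.1) e.2 := by
  have hmap := map_nbrs_unmarkedGraph hu hk (f := fun x => (liftOutput G rank y x).label)
    (g := fun e => some (y (.inl e.1) e.2))
    fun x e hx => by rw [hx.portNode.label_liftOutput, toNet_of_ne_inter e.1.2]; rfl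
  refine (Multiset.filterMap_map _ id _).symm.trans ((congrArg _ hmap).trans ?_)
  rw [Multiset.filterMap_map, ← Multiset.filterMap_eq_map]
  rfl

section White

variable (hu : ¬ Marked G rank u)
  (hw : ∀ w : (virtualGraph G rank).W, P.WhiteOk ((virtualGraph G rank).deg w) (y (.inl w)))

include hw

theorem OctopusRoot.whiteOk (h : OctopusRoot G rank r) :
    P.WhiteOk (portCount G rank r) (y (toNet G rank r)) := by
  have hk : G.node r ≠ .inter := by simp [h.head]
  rw [toNet_of_ne_inter hk]
  exact hw (whiteNode G rank r hk)

theorem pair_mem_pairs (hv : PortRoot G rank r i v) (hv' : PortRoot G rank r (i + 1) w)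
    (ha : (liftOutput G rank y v).label = some a) (hb : (liftOutput G rank y w).label = some b) :
    (a, b) ∈ P.pairs := by
  obtain rfl := Option.some.inj (hv.label_liftOutput.symm.trans ha)
  obtain rfl := Option.some.inj (hv'.label_liftOutput.symm.trans hb)
  exact (hv.octopusRoot.whiteOk hw).2 i hv'.lt

include hu

theorem mem_first (hk : G.node u = .head) (hleft : ¬ G.Has left u) (hs : G.Step port1 u v)
    (ha : (liftOutput G rank y v).label = some a) : a ∈ P.first := by
  obtain ⟨r, l, k, hr, hx⟩ := exists_octopusRoot hu hk
  have hp := portRoot_zero hr hx hleft hs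
  obtain rfl := Option.some.inj (hp.label_liftOutput.symm.trans ha)
  exact ((hr.whiteOk hw).1 hp.lt).1

theorem mem_last (hk : G.node u = .head) (hright : ¬ G.Has right u) (hs : LastPort G u v)
    (ha : (liftOutput G rank y v).label = some a) : a ∈ P.last := by
  obtain ⟨r, l, k, hr, hx⟩ := exists_octopusRoot hu hk
  obtain ⟨i, hp, hi⟩ := exists_portRoot_portCount hr hx hright hs
  obtain rfl := Option.some.inj (hp.label_liftOutput.symm.trans ha)
  have hlast := ((hr.whiteOk hw).1 (by omega)).2
  rwa [hi, Nat.add_sub_cancel] at hlast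

theorem pair_mem_pairs_of_leaf (hv : G.Step port1 u v) (hv' : G.Step port2 u w)
    (ha : (liftOutput G rank y v).label = some a) (hb : (liftOutput G rank y w).label = some b) :
    (a, b) ∈ P.pairs := by
  have hk := ((constraint_of_not_marked hu).of_step hv).2.1
  obtain ⟨r, l, k, hr, hx⟩ := exists_octopusRoot hu hk
  obtain ⟨i, hp, hp'⟩ := exists_portRoot_pair_of_leaf hr hx hv hv'
  exact pair_mem_pairs hw hp hp' ha hb

theorem pair_mem_pairs_of_step_right (hx : G.Step right u x) (hv : LastPort G u v)
    (hv' : G.Step port1 x w) (ha : (liftOutput G rank y v).label = some a)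
    (hb : (liftOutput G rank y w).label = some b) : (a, b) ∈ P.pairs := by
  have hc := constraint_of_not_marked hu
  have hk : G.node u = .head := by
    rcases hv with hv | ⟨-, hv⟩
    · exact (hc.of_step hv).2.1
    · exact (hc.of_step hv).2.1
  obtain ⟨r, l, k, hr, hur⟩ := exists_octopusRoot hu hk
  obtain ⟨i, hp, hp'⟩ := exists_portRoot_pair_of_step_right hr hur hx hv hv'
  exact pair_mem_pairs hw hp hp' ha hb

end White

theorem lastPort_unmarkedGraph_iff (hu : ¬ Marked G rank u) (hk : G.node u ≠ .inter) :
    LastPort (unmarkedGraph G rank) u v ↔ LastPort G u v :=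
  or_congr (step_unmarkedGraph_iff hu hk)
    (and_congr (not_congr (has_unmarkedGraph_iff hu hk)) (step_unmarkedGraph_iff hu hk))

theorem promiseRule_liftOutput
    (hw : ∀ w : (virtualGraph G rank).W, P.WhiteOk ((virtualGraph G rank).deg w) (y (.inl w)))
    (hb : ∀ b : (virtualGraph G rank).B,
      P.BlackOk (((virtualGraph G rank).edgesAt b).val.map fun e => y (.inl e.1) e.2))
    (hu : ¬ Marked G rank u) :
    PromiseRule (unmarkedGraph G rank) P (fun v => (liftOutput G rank y v).label) u := by
  have step {a x z} (h : (unmarkedGraph G rank).Step a x z) : G.Step a x z :=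
    (step_keep_iff.1 h).1
  have not_inter {x} (hx : G.Step right u x) : G.node u ≠ .inter :=
    ((constraint_of_not_marked hu).of_step hx).2.2
  have not_inter_of_head (hk : G.node u = .head) : G.node u ≠ .inter := by simp [hk]
  exact
    { port_iff := isSome_label_liftOutput_iff hu
      same_port := fun v ha hk hk' => label_liftOutput_eq_of_adj hu ha.1 hk hk'
      first := fun v a hk hleft hs ha => mem_first hu hw hk
        (mt (has_unmarkedGraph_iff hu (not_inter_of_head hk)).2 hleft) (step hs) ha
      last := fun v a hk hright hs ha => mem_last hu hw hk
        (mt (has_unmarkedGraph_iff hu (not_inter_of_head hk)).2 hright)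
        ((lastPort_unmarkedGraph_iff hu (not_inter_of_head hk)).1 hs) ha
      pair_same_leaf := fun v w a b hv hv' ha hb =>
        pair_mem_pairs_of_leaf hu hw (step hv) (step hv') ha hb
      pair_next_leaf := fun x v w a b hx hv hv' ha hb =>
        pair_mem_pairs_of_step_right hu hw (step hx)
          ((lastPort_unmarkedGraph_iff hu (not_inter (step hx))).1 hv) (step hv') ha hb
      black := fun hk => by
        have hb := hb (blackNode G rank u hk)
        rwa [← filterMap_label_liftOutput hu hk] at hb }

end LiftOutput

theorem valid_liftOutput {Γ : Type} {P : LinearizableProblem Γ} {G : GadgetGraph}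
    {y : (virtualGraph G P.rank).net.V → ℕ → Γ}
    (hy : P.problem.Valid ⟨virtualGraph G P.rank, card_edgesAt_le⟩ y) :
    (lift P).Valid G (liftOutput G P.rank y) := by
  have hset : {v | (liftOutput G P.rank y v).IsUnmarked} = {v | ¬ Marked G P.rank v} :=
    Set.ext fun _ => isUnmarked_liftOutput_iff
  refine fun u => ⟨badGraphRule_markOutput _ u, fun hu => ?_⟩
  rw [hset]
  exact promiseRule_liftOutput hy.1 hy.2 (isUnmarked_liftOutput_iff.1 hu)

end GadgetGraph

/-! ### The complexity of the lifted problem -/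

theorem exists_nodup_append_forall_mem {α : Type*} [Finite α] {l : List α} (hl : l.Nodup) :
    ∃ l' : List α, (l ++ l').Nodup ∧ ∀ a, a ∈ l ++ l' := by
  classical
  have := Fintype.ofFinite α
  refine ⟨(Finset.univ \ l.toFinset).toList, ?_, fun a => ?_⟩
  · rw [List.nodup_append']
    exact ⟨hl, Finset.nodup_toList _, fun a ha ha' => by simp_all⟩
  · simp [em]

namespace GadgetGraph

open LabeledGraph

theorem map_output_run_liftAlgorithm {Γ : Type} {A : SLOCALAlgorithm Color (Finset ℕ) (ℕ → Γ)}
    {G : GadgetGraph} {rank : ℕ} {T : ℕ → ℕ} {ident : G.V → ℕ} {order : List G.V} {u : G.V}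
    {y : (virtualGraph G rank).net.V → ℕ → Γ} (hi : ident.Injective) (horder : order.Nodup)
    (hu : u ∈ order)
    (hy : (virtualRun A rank T G ident order (virtualNode G rank u)).map A.output =
      some (y (virtualNode G rank u))) :
    ((liftAlgorithm A rank T).run G ident (radius T (Fintype.card G.V)) order u).map
      (liftAlgorithm A rank T).output = some (liftOutput G rank y u) := by
  obtain ⟨s, hs⟩ := exists_virtualRun_eq_some A T hu
  rw [hs, Option.map_some, Option.some.injEq] at hy
  rw [run_liftAlgorithm A T hi horder hu, hs, liftOutput, ← hy]
  rfl

theorem solvableInSLOCAL_lift {Γ : Type} {P : LinearizableProblem Γ} {c : ℕ} {T : ℕ → ℕ}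
    (hP : SolvableInSLOCAL c P.problem T) : SolvableInSLOCAL c (lift P) (radius T) := by
  obtain ⟨A, hA⟩ := hP
  refine ⟨liftAlgorithm A P.rank T, fun (G : GadgetGraph) ident hident order hnodup horder => ?_⟩
  let M : P.problem.Inst := ⟨virtualGraph G P.rank, card_edgesAt_le⟩
  have hcard : Fintype.card (P.problem.net M).V = Fintype.card G.V := card_net
  have hident' : IsIdentifierAssignment c (ident ∘ (toNet G P.rank).symm) :=
    ⟨hident.1.comp (toNet G P.rank).symm.injective, fun x => card_net (G := G) ▸ hident.2 _⟩
  obtain ⟨rest, hrest, hmem⟩ := exists_nodup_append_forall_mem (nodup_firstOccurrences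
    (order.map (virtualNode G P.rank)))
  obtain ⟨y, hy, hvalid⟩ := hA M _ hident' _ hrest hmem
  refine ⟨liftOutput G P.rank y, fun u =>
    map_output_run_liftAlgorithm hident.1 hnodup (horder u) ?_, valid_liftOutput hvalid⟩
  have hu : virtualNode G P.rank u ∈ firstOccurrences (order.map (virtualNode G P.rank)) :=
    mem_firstOccurrences.2 (List.mem_map_of_mem (horder u))
  have hyu := hy (virtualNode G P.rank u)
  rw [hcard] at hyu
  exact (congrArg _ (A.run_append_of_notMem _ _ _ _
    (List.disjoint_of_nodup_append hrest hu)).symm).trans hyu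

theorem isBigO_radius {T : ℕ → ℕ} (hT : ∀ᶠ n in atTop, 1 ≤ T n) :
    (fun n : ℕ => (radius T n : ℝ)) =O[atTop] fun n : ℕ => (T n : ℝ) * Real.log n := by
  refine IsBigO.of_bound 216 ?_
  filter_upwards [hT, eventually_ge_atTop 2] with n hTn hn
  have hlog : 1 ≤ Nat.log 2 n := Nat.log_pos one_lt_two hn
  have hle_log : (Nat.log 2 n : ℝ) ≤ 2 * Real.log n := by
    have hlog_two : (1 / 2 : ℝ) ≤ Real.log 2 := by linarith [Real.log_two_gt_d9]
    calc (Nat.log 2 n : ℝ) ≤ Real.log n / Real.log 2 := Real.natLog_le_logb n 2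
      _ ≤ Real.log n / (1 / 2) := by gcongr
      _ = 2 * Real.log n := by ring
  have hradius : radius T n ≤ 108 * (T n * Nat.log 2 n) :=
    calc radius T n ≤ 27 * Nat.log 2 n * (4 * T n) := Nat.mul_le_mul (by omega) (by omega)
      _ = 108 * (T n * Nat.log 2 n) := by ring
  rw [Real.norm_of_nonneg (by positivity),
    Real.norm_of_nonneg (mul_nonneg (by positivity) (Real.log_natCast_nonneg n))]
  calc (radius T n : ℝ) ≤ 108 * (T n * Nat.log 2 n) := by exact_mod_cast hradius
    _ ≤ 108 * (T n * (2 * Real.log n)) := by gcongr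
    _ = 216 * (T n * Real.log n) := by ring

end GadgetGraph

theorem mainTheorem6_general {Γ : Type} (P : LinearizableProblem Γ) {c : ℕ} {T : ℕ → ℕ}
    (hT : ∀ᶠ n in atTop, 1 ≤ T n) (hP : SolvableInSLOCAL c P.problem T) :
    ∃ T' : ℕ → ℕ, SolvableInSLOCAL c (lift P) T' ∧
      (fun n : ℕ => (T' n : ℝ)) =O[atTop] fun n : ℕ => (T n : ℝ) * Real.log n :=
  ⟨GadgetGraph.radius T, GadgetGraph.solvableInSLOCAL_lift hP, GadgetGraph.isBigO_radius hT⟩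

theorem mainTheorem6 {Γ : Type} [Finite Γ] (P : LinearizableProblem Γ) (c : ℕ) (hc : 1 ≤ c)
    (T : ℕ → ℕ) (hT : ∀ n, 1 ≤ T n) (hP : SolvableInSLOCAL c P.problem T) :
    ∃ T' : ℕ → ℕ, SolvableInSLOCAL c (lift P) T' ∧
      (fun n : ℕ => (T' n : ℝ)) =O[atTop] fun n : ℕ => (T n : ℝ) * Real.log n :=
  mainTheorem6_general P (.of_forall hT) hP
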